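/- For real $d>0$ consider the differential equation $$f''+\frac{f'}{r}-\frac{d^2}{r^2}f=-f(1-f^2),\qquad r>0, \tag{E$_d$}$$ for real-valued $C^2$ functions $f$ on an interval $]0,R[$, $0<R\le+\infty$. 1. For all $d>0$ and $a>0$ there exists a unique solution of (E$_d$) such that $\lim_{r\to0^+}\frac1a f(r)r^{-d}=1$. That is, there is such a solution on a largest interval $]0,R[$, and every solution on an interval $]0,R'[$ with this behaviour at $0$ satisfies $R'\le R$ and is the restriction of it to $]0,R'[$. 2. For every $d>0$ there exists a unique value $a=A_d>0$ for which this solution is defined on all of $]0,+\infty[$ and nondecreasing. 3. Denote this global nondecreasing solution by $f_d$. For every $d>0$, $$f_d(r)=1-\frac{d^2}{2r^2}+O\Big(\frac1{r^4}\Big)\quad\text{as } r\to+\infty,$$ and, as $r\to0^+$, $$f_d(r)=A_d\Big(r^d-\frac{1}{4(d+1)}r^{d+2}\Big)+\begin{cases}O(r^{d+4}) & \text{if } d\ge1,\\ O(r^{3d+2}) & \text{if } 0<d<1.\end{cases}$$ 4. Put $g^{(d)}(r)=r^{-d}f_d(r)$. For all $\alpha>0$, the map $d\mapsto g^{(d)}$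 is continuous from $]0,+\infty[$ into $L^\infty([0,\alpha])$. -/

import Mathlib

open Set Filter Topology MeasureTheory Asymptotics
open scoped ENNReal

namespace GinzburgLandau

/-- The interval `]0, R[`, where `R` may be `+∞`. -/
def interval (R : EReal) : Set ℝ := {r | 0 < r ∧ (r : EReal) < R}

/-- `f` is a classical solution, on `]0, R[` with `0 < R ≤ +∞`, of
`f'' + f' / r - (d² / r²) f = - f (1 - f²)`. Only the values of `f` on `]0, R[` matter. -/
def SolvesRadial (d : ℝ) (R : EReal) (f : ℝ → ℝ) : Prop :=
  0 < R ∧ ContDiffOn ℝ 2 f (interval R) ∧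
    ∀ r ∈ interval R,
      deriv (deriv f) r + deriv f r / r - d ^ 2 / r ^ 2 * f r = -(f r * (1 - f r ^ 2))

/-- `f` solves the equation on `]0, R[` and `(1 / a) f(r) r^{-d} → 1` as `r → 0⁺`. -/
def IsSolutionFromZero (d a : ℝ) (R : EReal) (f : ℝ → ℝ) : Prop :=
  SolvesRadial d R f ∧
    Tendsto (fun r : ℝ => 1 / a * f r * r ^ (-d)) (𝓝[>] 0) (𝓝 1)

/-- The solution with `f ~ a r^d` at `0` is defined on all of `]0, +∞[` and nondecreasing. -/
def IsGlobalMonotone (d a : ℝ) (f : ℝ → ℝ) : Prop :=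
  IsSolutionFromZero d a ⊤ f ∧ MonotoneOn f (Ioi 0)

end GinzburgLandau

/-!
# Radial Ginzburg–Landau profiles

Writing `f = r^d g`, the equation becomes `g'' + (2d+1) g'/r = - g (1 - r^{2d} g²)` with
`g(0) = a`, equivalently the integral equation `g = a - potential d (source)`, whose kernel has no
singularity at `0` (`eq_sub_potential_of_hasDerivAt`, `isRadialFlow_solution`). Grönwall's lemma
gives uniqueness, and the maximal solution is obtained by gluing (`exists_maximal_solution`).

For the global questions the factor `1 - f²` is replaced by `cutoff f = max 0 (1 - f²)`. The
truncated problem has a global solution `solution d a` for each `a`, by Banach's fixed point theorem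
in a weighted space (`exists_profile`), depending continuously on `(d, a)`
(`eventually_profile_near`), and it has the same solutions with values in `[-1, 1]`.

The monotone solution is found by shooting in `a > 0`. A truncated solution either exceeds `1` while
positive, or becomes negative while below `1`, or has values in `]0, 1]`
(`escapes_or_dips_or_stays`). The first two conditions are open and exclude each other. The first
holds for large `a`, fails for small `a`, and passes from `a` to larger coefficients by the
comparison principle `mul_solution_le`; hence the infimum of the escaping coefficients satisfies
neither, and belongs to the third class (`exists_stays`). There the solution is nondecreasing: once
`r f'` is negative it stays bounded away from `0` while `f > 0` (`momentum_le_of_neg`), which would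
drive `f` through `0`.
Such a solution tends to `1`, and two of them with different coefficients would have a ratio bounded
away from `1`, by comparison again (`Stays.unique`). Conversely a global nondecreasing solution is
at most `1`, as it would otherwise blow up (`le_one_of_isRadialFlow`). Openness of the two
conditions jointly in `(d, a)` yields continuity of `d ↦ A_d` (`continuous_of_stays`).

At infinity, `f - (1 - d²/(2r²))` solves a linear equation with a source `O(r⁻⁴)` and a zeroth
order coefficient tending to `2`, and the maximum principle with barrier `C/r⁴` applies
(`le_div_pow_four`). At `0` the expansion comes from iterating the integral equation.
-/

namespace GinzburgLandau

/-! ### The truncated nonlinearity -/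

/-- The truncated factor `max 0 (1 - z²)`; it replaces `1 - z²`, which makes the nonlinearity
`z (1 - z²)` globally Lipschitz and nonnegative on `z ≥ 0`. -/
def cutoff (z : ℝ) : ℝ := max 0 (1 - z ^ 2)

lemma continuous_cutoff : Continuous cutoff := by
  unfold cutoff; fun_prop

lemma cutoff_nonneg (z : ℝ) : 0 ≤ cutoff z := le_max_left _ _

lemma cutoff_le_one (z : ℝ) : cutoff z ≤ 1 :=
  max_le zero_le_one (by nlinarith [sq_nonneg z])

lemma cutoff_of_abs_le {z : ℝ} (h : |z| ≤ 1) : cutoff z = 1 - z ^ 2 := by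
  refine max_eq_right ?_
  have := (sq_le_one_iff_abs_le_one z).2 h
  linarith

lemma cutoff_of_le {z : ℝ} (h0 : 0 ≤ z) (h : z ≤ 1) : cutoff z = 1 - z ^ 2 :=
  cutoff_of_abs_le (abs_le.2 ⟨by linarith, h⟩)

lemma cutoff_of_one_le {z : ℝ} (h : 1 ≤ |z|) : cutoff z = 0 := by
  refine max_eq_left ?_
  have := (one_le_sq_iff_one_le_abs z).2 h
  linarith

lemma cutoff_antitone {y z : ℝ} (hy : 0 ≤ y) (h : y ≤ z) : cutoff z ≤ cutoff y :=
  max_le_max le_rfl (by nlinarith)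

lemma abs_mul_cutoff_sub_le (u v : ℝ) : |u * cutoff u - v * cutoff v| ≤ 2 * |u - v| := by
  have key : ∀ u v : ℝ, |u| ≤ 1 → 1 ≤ |v| → |u * cutoff u - v * cutoff v| ≤ 2 * |u - v| := by
    intro u v hu hv
    rw [cutoff_of_one_le hv, cutoff_of_abs_le hu, mul_zero, sub_zero, abs_mul, ← sq_abs u]
    have h1 : |v| - |u| ≤ |u - v| := by rw [abs_sub_comm]; exact abs_sub_abs_le_abs_sub v u
    rw [abs_of_nonneg (by nlinarith [abs_nonneg u] : (0 : ℝ) ≤ 1 - |u| ^ 2)]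
    nlinarith [abs_nonneg u, mul_nonneg (abs_nonneg u) (sub_nonneg.2 hu)]
  rcases le_total |u| 1 with hu | hu <;> rcases le_total |v| 1 with hv | hv
  · rw [cutoff_of_abs_le hu, cutoff_of_abs_le hv]
    have e : u * (1 - u ^ 2) - v * (1 - v ^ 2) = (u - v) * (1 - (u ^ 2 + u * v + v ^ 2)) := by ring
    rw [e, abs_mul, mul_comm]
    refine mul_le_mul_of_nonneg_right ?_ (abs_nonneg _)
    have hu' := (sq_le_one_iff_abs_le_one u).2 hu
    have hv' := (sq_le_one_iff_abs_le_one v).2 hv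
    rw [abs_le]
    constructor <;> nlinarith [sq_nonneg (u + v), sq_nonneg (u - v)]
  · exact key u v hu hv
  · rw [abs_sub_comm, abs_sub_comm u v]; exact key v u hv hu
  · rw [cutoff_of_one_le hu, cutoff_of_one_le hv]; simp

lemma abs_mul_cutoff_mul_sub_le (c y z : ℝ) :
    |y * cutoff (c * y) - z * cutoff (c * z)| ≤ 2 * |y - z| := by
  rcases eq_or_ne c 0 with rfl | hc
  · have : cutoff 0 = 1 := by simp [cutoff]
    simp only [zero_mul, this, mul_one]
    linarith [abs_nonneg (y - z)]
  · have h := abs_mul_cutoff_sub_le (c * y) (c * z)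
    have e : c * y * cutoff (c * y) - c * z * cutoff (c * z)
        = c * (y * cutoff (c * y) - z * cutoff (c * z)) := by ring
    rw [e, ← mul_sub, abs_mul, abs_mul] at h
    have hc' : 0 < |c| := abs_pos.2 hc
    refine le_of_mul_le_mul_left ?_ hc'
    linarith

lemma abs_mul_cutoff_le (c y : ℝ) : |y * cutoff (c * y)| ≤ |y| := by
  rw [abs_mul, abs_of_nonneg (cutoff_nonneg _)]
  exact mul_le_of_le_one_right (abs_nonneg y) (cutoff_le_one _)

/-! ### The integral operator inverting the radial Laplacian -/

/-- Kernel of the inverse of `u ↦ u'' + (2d+1) u'/r` with zero data at `0`, after rescaling `]0, r[`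
to `]0, 1[`. -/
noncomputable def kernel (d s : ℝ) : ℝ := s * (1 - s ^ (2 * d)) / (2 * d)

/-- The solution `u` of `u'' + (2d+1) u'/r = h`, `u(0) = u'(0) = 0`. The integral over `]0, r[` is
rescaled to `]0, 1[`, which makes continuity in `d` and in `r` (at `r = 0` too) visible. -/
noncomputable def potential (d : ℝ) (h : ℝ → ℝ) (r : ℝ) : ℝ :=
  r ^ 2 * ∫ s in (0 : ℝ)..1, kernel d s * h (r * s)

lemma continuous_kernel {d : ℝ} (hd : 0 < d) : Continuous (kernel d) := by
  unfold kernel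
  have : Continuous fun s : ℝ => s ^ (2 * d) := Real.continuous_rpow_const (by linarith)
  fun_prop

lemma kernel_nonneg {d s : ℝ} (hd : 0 < d) (h0 : 0 ≤ s) (h1 : s ≤ 1) : 0 ≤ kernel d s := by
  have := Real.rpow_le_one h0 h1 (by linarith : 0 ≤ 2 * d)
  unfold kernel
  exact div_nonneg (mul_nonneg h0 (by linarith)) (by linarith)

lemma kernel_le {d s : ℝ} (hd : 0 < d) (h0 : 0 ≤ s) : kernel d s ≤ s / (2 * d) := by
  have := Real.rpow_nonneg h0 (2 * d)
  unfold kernel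
  gcongr
  nlinarith

lemma continuous_potential_integrand {d : ℝ} (hd : 0 < d) {h : ℝ → ℝ} (hh : Continuous h) (r : ℝ) :
    Continuous fun s => kernel d s * h (r * s) :=
  (continuous_kernel hd).mul (hh.comp (by fun_prop))

lemma continuous_potential {d : ℝ} (hd : 0 < d) {h : ℝ → ℝ} (hh : Continuous h) :
    Continuous (potential d h) := by
  unfold potential
  refine (continuous_pow 2).mul ?_
  refine intervalIntegral.continuous_parametric_intervalIntegral_of_continuous' ?_ 0 1
  have := continuous_kernel hd
  exact (this.comp continuous_snd).mul (hh.comp (by fun_prop))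

lemma potential_sub {d : ℝ} (hd : 0 < d) {h k : ℝ → ℝ} (hh : Continuous h) (hk : Continuous k)
    (r : ℝ) : potential d h r - potential d k r = potential d (fun t => h t - k t) r := by
  unfold potential
  rw [← mul_sub, ← intervalIntegral.integral_sub
    ((continuous_potential_integrand hd hh r).intervalIntegrable _ _)
    ((continuous_potential_integrand hd hk r).intervalIntegrable _ _)]
  simp only [mul_sub]

lemma abs_potential_le_integral {d : ℝ} (hd : 0 < d) {h k : ℝ → ℝ} (hk : Continuous k) {r : ℝ}
    (hr : 0 ≤ r) (hb : ∀ t ∈ Icc 0 r, |h t| ≤ k t) :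
    |potential d h r| ≤ 1 / (2 * d) * ∫ t in (0 : ℝ)..r, t * k t := by
  have e : ∫ t in (0 : ℝ)..r, t * k t = r * ∫ s in (0 : ℝ)..1, (r * s) * k (r * s) := by
    have := intervalIntegral.mul_integral_comp_mul_left (a := 0) (b := 1) (f := fun t => t * k t) r
    simpa using this.symm
  have h1 : |∫ s in (0 : ℝ)..1, kernel d s * h (r * s)|
      ≤ ∫ s in (0 : ℝ)..1, s / (2 * d) * k (r * s) := by
    have hc : Continuous fun s => s / (2 * d) * k (r * s) := by fun_prop
    rw [← Real.norm_eq_abs]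
    refine intervalIntegral.norm_integral_le_of_norm_le zero_le_one
      (Eventually.of_forall fun s hs => ?_) (hc.intervalIntegrable _ _)
    rw [Real.norm_eq_abs, abs_mul, abs_of_nonneg (kernel_nonneg hd hs.1.le hs.2)]
    have hrs : r * s ∈ Icc 0 r := ⟨mul_nonneg hr hs.1.le, mul_le_of_le_one_right hr hs.2⟩
    exact mul_le_mul (kernel_le hd hs.1.le) (hb _ hrs) (abs_nonneg _)
      (div_nonneg hs.1.le (by linarith))
  unfold potential
  rw [abs_mul, abs_of_nonneg (sq_nonneg r), e]
  refine (mul_le_mul_of_nonneg_left h1 (sq_nonneg r)).trans_eq ?_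
  rw [← intervalIntegral.integral_const_mul, ← intervalIntegral.integral_const_mul,
    ← intervalIntegral.integral_const_mul]
  congr 1; ext s; field_simp

lemma abs_potential_le_const {d : ℝ} (hd : 0 < d) {h : ℝ → ℝ} {M r : ℝ} (hr : 0 ≤ r)
    (hb : ∀ t ∈ Icc 0 r, |h t| ≤ M) : |potential d h r| ≤ M * r ^ 2 / (4 * d) := by
  refine (abs_potential_le_integral hd (k := fun _ => M) continuous_const hr hb).trans_eq ?_
  rw [intervalIntegral.integral_mul_const, integral_id]
  field_simp; ring

lemma abs_potential_le_mul_integral {d : ℝ} (hd : 0 < d) {h k : ℝ → ℝ} (hk : Continuous k)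
    {r ρ : ℝ} (hr : 0 ≤ r) (hρ : r ≤ ρ) (hb : ∀ t ∈ Icc 0 r, |h t| ≤ k t) :
    |potential d h r| ≤ ρ / (2 * d) * ∫ t in (0 : ℝ)..r, k t := by
  refine (abs_potential_le_integral hd hk hr hb).trans ?_
  have : ∫ t in (0 : ℝ)..r, t * k t ≤ ∫ t in (0 : ℝ)..r, ρ * k t := by
    refine intervalIntegral.integral_mono_on hr ((by fun_prop : Continuous _).intervalIntegrable _ _)
      ((by fun_prop : Continuous _).intervalIntegrable _ _) fun t ht => ?_
    exact mul_le_mul_of_nonneg_right (ht.2.trans hρ) ((abs_nonneg _).trans (hb t ht))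
  rw [intervalIntegral.integral_const_mul] at this
  calc _ ≤ 1 / (2 * d) * (ρ * ∫ t in (0 : ℝ)..r, k t) :=
        mul_le_mul_of_nonneg_left this (by positivity)
    _ = _ := by ring

lemma potential_nonneg {d : ℝ} (hd : 0 < d) {h : ℝ → ℝ} {r : ℝ} (hr : 0 ≤ r)
    (hb : ∀ t ∈ Icc 0 r, 0 ≤ h t) : 0 ≤ potential d h r := by
  refine mul_nonneg (sq_nonneg r) (intervalIntegral.integral_nonneg zero_le_one fun s hs => ?_)
  exact mul_nonneg (kernel_nonneg hd hs.1 hs.2)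
    (hb _ ⟨mul_nonneg hr hs.1, mul_le_of_le_one_right hr hs.2⟩)

/-- Under the Gaussian growth `e^{λ t²}` the operator gains the small factor `1 / (4dλ)`. -/
lemma abs_potential_le_exp {d l M : ℝ} (hd : 0 < d) (hl : 0 < l) {h : ℝ → ℝ} (hM : 0 ≤ M)
    (hb : ∀ t, |h t| ≤ M * Real.exp (l * t ^ 2)) (r : ℝ) :
    |potential d h r| ≤ M * Real.exp (l * r ^ 2) / (4 * d * l) := by
  have hder : ∀ s : ℝ, HasDerivAt (fun s => M * Real.exp (l * (r * s) ^ 2) / (4 * d * l))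
      (r ^ 2 * (s / (2 * d) * (M * Real.exp (l * (r * s) ^ 2)))) s := by
    intro s
    have h1 : HasDerivAt (fun s : ℝ => l * (r * s) ^ 2) (l * (2 * (r * s) * r)) s := by
      have := (((hasDerivAt_id s).const_mul r).pow 2).const_mul l
      simpa using this
    convert! (h1.exp.const_mul M).div_const (4 * d * l) using 1
    field_simp; ring
  have hc : Continuous fun s => r ^ 2 * (s / (2 * d) * (M * Real.exp (l * (r * s) ^ 2))) := by
    fun_prop
  have hint := intervalIntegral.integral_eq_sub_of_hasDerivAt (a := 0) (b := 1)
    (fun s _ => hder s) (hc.intervalIntegrable _ _)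
  have h1 : |∫ s in (0 : ℝ)..1, r ^ 2 * (kernel d s * h (r * s))|
      ≤ ∫ s in (0 : ℝ)..1, r ^ 2 * (s / (2 * d) * (M * Real.exp (l * (r * s) ^ 2))) := by
    rw [← Real.norm_eq_abs]
    refine intervalIntegral.norm_integral_le_of_norm_le zero_le_one
      (Eventually.of_forall fun s hs => ?_) (hc.intervalIntegrable _ _)
    rw [Real.norm_eq_abs, abs_mul, abs_mul, abs_of_nonneg (sq_nonneg r),
      abs_of_nonneg (kernel_nonneg hd hs.1.le hs.2)]
    refine mul_le_mul_of_nonneg_left ?_ (sq_nonneg r)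
    exact mul_le_mul (kernel_le hd hs.1.le) (hb _) (abs_nonneg _)
      (div_nonneg hs.1.le (by linarith))
  rw [intervalIntegral.integral_const_mul, hint] at h1
  refine h1.trans ?_
  simp only [mul_one, mul_zero]
  have : 0 ≤ M * Real.exp (l * 0 ^ 2) / (4 * d * l) := by positivity
  simpa using this

/-! ### The integral equation and its solutions -/

/-- The right-hand side of the equation for the profile `g(r) = r^{-d} f(r)`. -/
noncomputable def source (d : ℝ) (g : ℝ → ℝ) (t : ℝ) : ℝ := g t * cutoff (t ^ d * g t)

lemma continuous_source {d : ℝ} (hd : 0 < d) {g : ℝ → ℝ} (hg : Continuous g) :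
    Continuous (source d g) := by
  have : Continuous fun s : ℝ => s ^ d := Real.continuous_rpow_const hd.le
  exact hg.mul (continuous_cutoff.comp (this.mul hg))

lemma abs_source_le (d : ℝ) (g : ℝ → ℝ) (t : ℝ) : |source d g t| ≤ |g t| := abs_mul_cutoff_le _ _

lemma abs_source_sub_le (d : ℝ) (g k : ℝ → ℝ) (t : ℝ) :
    |source d g t - source d k t| ≤ 2 * |g t - k t| := abs_mul_cutoff_mul_sub_le _ _ _

/-- Existence for the truncated integral equation on the whole line: Banach's fixed point theorem
for `e^{-r²/d} g(r)` among bounded continuous functions, where the contraction factor is `1/2`. -/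
theorem exists_profile {d : ℝ} (hd : 0 < d) (a : ℝ) :
    ∃ g : ℝ → ℝ, Continuous g ∧ ∀ r, g r = a - potential d (source d g) r := by
  set l : ℝ := 1 / d with hl
  have hl0 : 0 < l := by positivity
  have hdl : 4 * d * l = 4 := by rw [hl]; field_simp
  let w : ℝ → ℝ := fun r => Real.exp (l * r ^ 2)
  have hw : Continuous w := by fun_prop
  have hw1 : ∀ r, 1 ≤ w r := fun r => Real.one_le_exp (by positivity)
  have hw0 : ∀ r, 0 < w r := fun r => Real.exp_pos _
  let B := BoundedContinuousFunction ℝ ℝ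
  let lift : B → ℝ → ℝ := fun G r => w r * G r
  have hlift : ∀ G, Continuous (lift G) := fun G => hw.mul G.continuous
  have hsrc : ∀ G, Continuous (source d (lift G)) := fun G => continuous_source hd (hlift G)
  have habs : ∀ G r, |source d (lift G) r| ≤ ‖G‖ * w r := by
    intro G r
    refine (abs_source_le _ _ _).trans ?_
    rw [abs_mul, abs_of_pos (hw0 r), mul_comm]
    exact mul_le_mul_of_nonneg_right (G.norm_coe_le_norm r) (hw0 r).le
  let S : B → B := fun G => BoundedContinuousFunction.ofNormedAddCommGroup
    (fun r => (w r)⁻¹ * (a - potential d (source d (lift G)) r))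
    ((hw.inv₀ fun r => (hw0 r).ne').mul (continuous_const.sub (continuous_potential hd (hsrc G))))
    (|a| + ‖G‖ / 4) (by
      intro r
      have h := abs_potential_le_exp hd hl0 (norm_nonneg G) (habs G) r
      rw [hdl] at h
      rw [Real.norm_eq_abs, abs_mul, abs_inv, abs_of_pos (hw0 r), inv_mul_le_iff₀ (hw0 r)]
      calc _ ≤ |a| + |potential d (source d (lift G)) r| := abs_sub _ _
        _ ≤ w r * |a| + ‖G‖ * w r / 4 :=
          add_le_add (le_mul_of_one_le_left (abs_nonneg a) (hw1 r)) h
        _ = _ := by ring)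
  have hSapp : ∀ G r, S G r = (w r)⁻¹ * (a - potential d (source d (lift G)) r) := fun _ _ => rfl
  have hS : ContractingWith (1 / 2) S := by
    refine ⟨by rw [← NNReal.coe_lt_coe]; norm_num, LipschitzWith.of_dist_le_mul fun G H => ?_⟩
    refine (BoundedContinuousFunction.dist_le (by positivity)).2 fun r => ?_
    have hb : ∀ t, |source d (lift G) t - source d (lift H) t| ≤ (2 * dist G H) * w t := by
      intro t
      refine (abs_source_sub_le _ _ _ _).trans ?_
      have : lift G t - lift H t = w t * (G t - H t) := by simp only [lift]; ring
      rw [this, abs_mul, abs_of_pos (hw0 t)]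
      have h2 := BoundedContinuousFunction.dist_coe_le_dist (f := G) (g := H) t
      rw [Real.dist_eq] at h2
      nlinarith [hw0 t]
    have h := abs_potential_le_exp hd hl0 (by positivity) hb r
    rw [hdl] at h
    have e : S G r - S H r = -(w r)⁻¹ *
        (potential d (source d (lift G)) r - potential d (source d (lift H)) r) := by
      rw [hSapp, hSapp]; ring
    rw [Real.dist_eq, e, potential_sub hd (hsrc G) (hsrc H), abs_mul, abs_neg, abs_inv,
      abs_of_pos (hw0 r), inv_mul_le_iff₀ (hw0 r)]
    refine h.trans_eq ?_
    simp only [w]; push_cast; ring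
  let G := ContractingWith.fixedPoint S hS
  have hG : S G = G := hS.fixedPoint_isFixedPt
  refine ⟨lift G, hlift G, fun r => ?_⟩
  have h := congrArg (fun F : B => F r) hG
  change w r * G r = _
  rw [← h, hSapp, mul_inv_cancel_left₀ (hw0 r).ne']

open Classical in
/-- The profile `g(r) = r^{-d} f(r)` of the solution of the truncated equation with `f ~ a r^d`;
the junk value `0` is taken when `d ≤ 0`. -/
noncomputable def profile (d a : ℝ) : ℝ → ℝ :=
  if hd : 0 < d then (exists_profile hd a).choose else 0

lemma continuous_profile {d : ℝ} (hd : 0 < d) (a : ℝ) : Continuous (profile d a) := by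
  rw [profile, dif_pos hd]; exact (exists_profile hd a).choose_spec.1

lemma profile_eq {d : ℝ} (hd : 0 < d) (a r : ℝ) :
    profile d a r = a - potential d (source d (profile d a)) r := by
  rw [profile, dif_pos hd]; exact (exists_profile hd a).choose_spec.2 r

lemma profile_zero {d : ℝ} (hd : 0 < d) (a : ℝ) : profile d a 0 = a := by
  rw [profile_eq hd]; simp [potential]

lemma continuous_source_profile {d : ℝ} (hd : 0 < d) (a : ℝ) :
    Continuous (source d (profile d a)) := continuous_source hd (continuous_profile hd a)

/-- Grönwall's lemma in integral form. -/
lemma le_mul_exp_of_le_add_integral {u : ℝ → ℝ} (hu : Continuous u) (hu0 : ∀ t, 0 ≤ u t)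
    {e C ρ : ℝ} (hC : 0 < C)
    (h : ∀ r ∈ Icc 0 ρ, u r ≤ e + C * ∫ t in (0 : ℝ)..r, u t) :
    ∀ r ∈ Icc 0 ρ, u r ≤ e * Real.exp (C * r) := by
  have hder : ∀ r, HasDerivAt (fun r => ∫ t in (0 : ℝ)..r, u t) (u r) r := fun r =>
    intervalIntegral.integral_hasDerivAt_right (hu.intervalIntegrable _ _)
      (hu.stronglyMeasurableAtFilter _ _) hu.continuousAt
  intro r hr
  have hpos : ∀ x, 0 ≤ x → 0 ≤ ∫ t in (0 : ℝ)..x, u t := fun x hx =>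
    intervalIntegral.integral_nonneg hx fun t _ => hu0 t
  have := norm_le_gronwallBound_of_norm_deriv_right_le (f := fun r => ∫ t in (0 : ℝ)..r, u t)
    (f' := u) (δ := 0) (K := C) (ε := e) (a := 0) (b := ρ)
    (fun x _ => (hder x).continuousAt.continuousWithinAt)
    (fun x _ => (hder x).hasDerivWithinAt) (by simp)
    (fun x hx => by
      rw [Real.norm_eq_abs, Real.norm_eq_abs, abs_of_nonneg (hu0 x), abs_of_nonneg (hpos x hx.1),
        add_comm]
      exact h x ⟨hx.1, hx.2.le⟩) r hr
  rw [Real.norm_eq_abs, abs_of_nonneg (hpos r hr.1), gronwallBound_of_K_ne_0 hC.ne', sub_zero] at this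
  simp only [zero_mul, zero_add] at this
  have h2 := mul_le_mul_of_nonneg_left this hC.le
  have h3 : C * (e / C * (Real.exp (C * r) - 1)) = e * (Real.exp (C * r) - 1) := by field_simp
  linarith [h r hr]

/-- Profiles depend continuously on `(d, a)`, uniformly on compact intervals of `r`. -/
theorem eventually_profile_near (d₀ : Ioi (0 : ℝ)) (a₀ α : ℝ) {e : ℝ} (he : 0 < e) :
    ∀ᶠ p : Ioi (0 : ℝ) × ℝ in 𝓝 (d₀, a₀),
      ∀ r ∈ Icc 0 α, |profile p.1 p.2 r - profile d₀ a₀ r| ≤ e := by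
  rcases lt_or_ge α 0 with hα | hα
  · simp [Icc_eq_empty_of_lt hα]
  have hd₀ : (0 : ℝ) < d₀ := d₀.2
  set g₀ := profile d₀ a₀ with hg₀
  have hg₀c : Continuous g₀ := continuous_profile hd₀ a₀
  -- the Grönwall constant is uniform for `d > d₀ / 2`
  set C : ℝ := α / d₀ * 2 + 1 with hC
  have hC0 : 0 < C := by positivity
  have hX : Continuous fun x : (Ioi (0 : ℝ) × ℝ) × ℝ =>
      potential (x.1.1 : ℝ) (source (x.1.1 : ℝ) g₀) x.2 := by
    unfold potential
    refine (continuous_snd.pow 2).mul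
      (intervalIntegral.continuous_parametric_intervalIntegral_of_continuous' ?_ 0 1)
    have hp : ∀ (φ ψ : ((Ioi (0 : ℝ) × ℝ) × ℝ) × ℝ → ℝ), Continuous φ → Continuous ψ →
        (∀ x, 0 < ψ x) → Continuous fun x => φ x ^ ψ x := fun φ ψ hφ hψ h =>
      hφ.rpow hψ fun x => Or.inr (h x)
    have hpos : ∀ x : ((Ioi (0 : ℝ) × ℝ) × ℝ) × ℝ, (0 : ℝ) < x.1.1.1 := fun x => x.1.1.1.2
    have hdc : Continuous fun x : ((Ioi (0 : ℝ) × ℝ) × ℝ) × ℝ => (x.1.1.1 : ℝ) := by fun_prop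
    have h1 := hp (fun x => x.2) (fun x => 2 * (x.1.1.1 : ℝ)) continuous_snd (by fun_prop)
      fun x => by linarith [hpos x]
    have h2 := hp (fun x => x.1.2 * x.2) (fun x => (x.1.1.1 : ℝ)) (by fun_prop) hdc hpos
    refine Continuous.mul ?_ ?_
    · exact (continuous_snd.mul (continuous_const.sub h1)).div (by fun_prop)
        fun x => by linarith [hpos x]
    · have h3 : Continuous fun x : ((Ioi (0 : ℝ) × ℝ) × ℝ) × ℝ => g₀ (x.1.2 * x.2) :=
        hg₀c.comp (by fun_prop)
      exact h3.mul (continuous_cutoff.comp (h2.mul h3))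
  have hη : 0 < e * Real.exp (-(C * α)) := by positivity
  have hnear : ∀ᶠ p : Ioi (0 : ℝ) × ℝ in 𝓝 (d₀, a₀), ∀ r ∈ Icc 0 α,
      |(p.2 - potential (p.1 : ℝ) (source (p.1 : ℝ) g₀) r) - g₀ r|
        < e * Real.exp (-(C * α)) := by
    refine isCompact_Icc.eventually_forall_of_forall_eventually fun r _ => ?_
    have hc : Continuous fun x : (Ioi (0 : ℝ) × ℝ) × ℝ =>
        |(x.1.2 - potential (x.1.1 : ℝ) (source (x.1.1 : ℝ) g₀) x.2) - g₀ x.2| := by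
      have : Continuous fun x : (Ioi (0 : ℝ) × ℝ) × ℝ => g₀ x.2 := hg₀c.comp continuous_snd
      fun_prop
    refine (hc.tendsto ((d₀, a₀), r)).eventually (gt_mem_nhds ?_)
    have := profile_eq hd₀ a₀ r
    rw [← hg₀] at this
    simp only
    rw [← this, sub_self, abs_zero]
    exact hη
  have hdnear : ∀ᶠ p : Ioi (0 : ℝ) × ℝ in 𝓝 (d₀, a₀), (d₀ : ℝ) / 2 < p.1 := by
    have hc : Continuous fun p : Ioi (0 : ℝ) × ℝ => (p.1 : ℝ) := by fun_prop
    exact (hc.tendsto (d₀, a₀)).eventually (lt_mem_nhds (by simp only; linarith))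
  filter_upwards [hnear, hdnear] with p hp hpd
  have hd : (0 : ℝ) < p.1 := p.1.2
  have hgc := continuous_profile hd p.2
  have key := le_mul_exp_of_le_add_integral (u := fun t => |profile p.1 p.2 t - g₀ t|)
    (by fun_prop) (fun t => abs_nonneg _) (e := e * Real.exp (-(C * α))) (ρ := α) hC0 (by
      intro r hr
      have h1 := abs_potential_le_mul_integral hd (ρ := α)
        (h := fun t => source p.1 (profile p.1 p.2) t - source p.1 g₀ t)
        (k := fun t => 2 * |profile p.1 p.2 t - g₀ t|) (by fun_prop) hr.1 hr.2
        (fun t _ => abs_source_sub_le _ _ _ _)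
      rw [← potential_sub hd (continuous_source hd hgc) (continuous_source hd hg₀c),
        intervalIntegral.integral_const_mul] at h1
      have hI : 0 ≤ ∫ t in (0 : ℝ)..r, |profile p.1 p.2 t - g₀ t| :=
        intervalIntegral.integral_nonneg hr.1 fun t _ => abs_nonneg _
      have h2 : α / (2 * (p.1 : ℝ)) * 2 ≤ C := by
        have : α / (2 * (p.1 : ℝ)) ≤ α / d₀ := by
          apply div_le_div_of_nonneg_left hα hd₀; linarith
        rw [hC]; linarith
      have h3 : α / (2 * (p.1 : ℝ)) * (2 * ∫ t in (0 : ℝ)..r, |profile p.1 p.2 t - g₀ t|)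
          ≤ C * ∫ t in (0 : ℝ)..r, |profile p.1 p.2 t - g₀ t| := by
        rw [← mul_assoc]; exact mul_le_mul_of_nonneg_right h2 hI
      have h4 := hp r hr
      have h5 := profile_eq hd p.2 r
      rw [abs_le] at h1
      rw [abs_lt] at h4
      rw [abs_le]
      constructor <;> linarith)
  intro r hr
  refine (key r hr).trans ?_
  rw [mul_assoc, ← Real.exp_add]
  refine mul_le_of_le_one_right he.le (Real.exp_le_one_iff.2 ?_)
  nlinarith [hr.2]

/-! ### From the integral equation to the differential equation and back -/

/-- First moment `∫₀ʳ t h(t) dt`. -/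
noncomputable def lowMoment (h : ℝ → ℝ) (r : ℝ) : ℝ := ∫ t in (0 : ℝ)..r, t * h t

/-- The moment `∫₀ʳ t^{2d+1} h(t) dt`. -/
noncomputable def highMoment (d : ℝ) (h : ℝ → ℝ) (r : ℝ) : ℝ :=
  ∫ t in (0 : ℝ)..r, t ^ (2 * d + 1) * h t

lemma continuous_highMoment_integrand {d : ℝ} (hd : 0 < d) {h : ℝ → ℝ} (hh : Continuous h) :
    Continuous fun t => t ^ (2 * d + 1) * h t :=
  (Real.continuous_rpow_const (by linarith)).mul hh

lemma hasDerivAt_lowMoment {h : ℝ → ℝ} (hh : Continuous h) (r : ℝ) :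
    HasDerivAt (lowMoment h) (r * h r) r := by
  have hc : Continuous fun t => t * h t := continuous_id.mul hh
  exact intervalIntegral.integral_hasDerivAt_right (hc.intervalIntegrable _ _)
      (hc.stronglyMeasurableAtFilter _ _) hc.continuousAt

lemma hasDerivAt_highMoment {d : ℝ} (hd : 0 < d) {h : ℝ → ℝ} (hh : Continuous h) (r : ℝ) :
    HasDerivAt (highMoment d h) (r ^ (2 * d + 1) * h r) r := by
  have hc := continuous_highMoment_integrand hd hh
  exact intervalIntegral.integral_hasDerivAt_right (hc.intervalIntegrable _ _)
      (hc.stronglyMeasurableAtFilter _ _) hc.continuousAt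

lemma rpow_neg_mul_rpow {r : ℝ} (hr : 0 < r) (d : ℝ) : r ^ (-d) * r ^ d = 1 := by
  rw [← Real.rpow_add hr, neg_add_cancel, Real.rpow_zero]

lemma rpow_two_mul_add_one {r : ℝ} (hr : 0 < r) (d : ℝ) : r ^ (2 * d + 1) = r ^ d * r ^ d * r := by
  rw [Real.rpow_add_one hr.ne', two_mul, Real.rpow_add hr]

lemma rpow_neg_two_mul {r : ℝ} (hr : 0 < r) (d : ℝ) : r ^ (-(2 * d)) = r ^ (-d) * r ^ (-d) := by
  rw [← Real.rpow_add hr]; congr 1; ring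

lemma potential_eq_moments {d : ℝ} (hd : 0 < d) {h : ℝ → ℝ} (hh : Continuous h) {r : ℝ}
    (hr : 0 < r) : potential d h r
      = (lowMoment h r - r ^ (-d) * r ^ (-d) * highMoment d h r) / (2 * d) := by
  have hc1 : Continuous fun t => t * h t := continuous_id.mul hh
  have hc2 := continuous_highMoment_integrand hd hh
  have hc3 : Continuous fun t => r ^ (-(2 * d)) * (t ^ (2 * d + 1) * h t) :=
    continuous_const.mul hc2
  rw [← rpow_neg_two_mul hr]
  have e := intervalIntegral.mul_integral_comp_mul_left (a := 0) (b := 1)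
    (f := fun t => (t * h t - r ^ (-(2 * d)) * (t ^ (2 * d + 1) * h t)) / (2 * d)) r
  have e2 : ∫ t in (0 : ℝ)..r, (t * h t - r ^ (-(2 * d)) * (t ^ (2 * d + 1) * h t)) / (2 * d)
      = (lowMoment h r - r ^ (-(2 * d)) * highMoment d h r) / (2 * d) := by
    rw [intervalIntegral.integral_div, intervalIntegral.integral_sub (hc1.intervalIntegrable _ _)
      (hc3.intervalIntegrable _ _), intervalIntegral.integral_const_mul]
    rfl
  rw [mul_zero, mul_one] at e
  rw [← e2, ← e, potential, sq, mul_assoc, ← intervalIntegral.integral_const_mul]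
  congr 1
  refine intervalIntegral.integral_congr fun s hs => ?_
  rw [uIcc_of_le zero_le_one] at hs
  have h1 : r ^ (-(2 * d)) * (r * s) ^ (2 * d + 1) = r * (s * s ^ (2 * d)) := by
    rw [Real.mul_rpow hr.le hs.1, Real.rpow_add_one hr.ne', Real.rpow_add_one' hs.1 (by linarith)]
    have := rpow_neg_mul_rpow hr (2 * d)
    linear_combination (r * (s * s ^ (2 * d))) * this
  rw [← mul_assoc (r ^ (-(2 * d))), h1, kernel]
  ring

/-- Variation of constants: the two functions solve `r f' = p`,
`r p' = d² f - r² (r^d h)`. -/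
lemma hasDerivAt_variation {d : ℝ} (hd : 0 < d) {h : ℝ → ℝ} (hh : Continuous h) (a : ℝ) {r : ℝ}
    (hr : 0 < r) :
    HasDerivAt (fun r => r ^ d * (a - lowMoment h r / (2 * d))
        + r ^ (-d) * highMoment d h r / (2 * d))
      ((r ^ d * (d * a - lowMoment h r / 2) - r ^ (-d) * highMoment d h r / 2) / r) r ∧
    HasDerivAt (fun r => r ^ d * (d * a - lowMoment h r / 2) - r ^ (-d) * highMoment d h r / 2)
      (d ^ 2 * (r ^ d * (a - lowMoment h r / (2 * d))
        + r ^ (-d) * highMoment d h r / (2 * d)) / r - r * (r ^ d * h r)) r := by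
  have h1 := Real.hasDerivAt_rpow_const (x := r) (p := d) (Or.inl hr.ne')
  have h2 := Real.hasDerivAt_rpow_const (x := r) (p := -d) (Or.inl hr.ne')
  rw [Real.rpow_sub_one hr.ne'] at h1 h2
  have h3 := hasDerivAt_lowMoment hh r
  have h4 := hasDerivAt_highMoment hd hh r
  rw [rpow_two_mul_add_one hr] at h4
  have hXY := rpow_neg_mul_rpow hr d
  constructor
  · convert! (h1.mul ((h3.div_const (2 * d)).const_sub a)).add ((h2.mul h4).div_const (2 * d))
      using 1
    field_simp
    linear_combination (-(r ^ d * r ^ 2 * h r)) * hXY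
  · convert! (h1.mul ((h3.div_const 2).const_sub (d * a))).sub ((h2.mul h4).div_const 2) using 1
    field_simp
    linear_combination (r ^ d * r ^ 2 * h r) * hXY

/-- `f` and `p = r f'` solve the equation, with nonlinearity `f q(f)`, at each point of `s`,
written as a first order system. -/
def IsRadialFlow (d : ℝ) (q : ℝ → ℝ) (s : Set ℝ) (f p : ℝ → ℝ) : Prop :=
  ∀ r ∈ s, HasDerivAt f (p r / r) r ∧
    HasDerivAt p (d ^ 2 * f r / r - r * (f r * q (f r))) r

lemma isOpen_interval (R : EReal) : IsOpen (interval R) :=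
  isOpen_Ioi.inter (isOpen_lt continuous_coe_real_ereal continuous_const)

lemma interval_top : interval ⊤ = Ioi 0 := by
  ext r; simp [interval, EReal.coe_lt_top]

lemma interval_coe (ρ : ℝ) : interval ρ = Ioo 0 ρ := by
  ext r; simp [interval]

lemma Ioc_subset_interval {R : EReal} {ρ : ℝ} (h : (ρ : EReal) < R) : Ioc 0 ρ ⊆ interval R :=
  fun _ hr => ⟨hr.1, (EReal.coe_le_coe_iff.2 hr.2).trans_lt h⟩

lemma exists_lt_of_mem_interval {R : EReal} {r : ℝ} (h : r ∈ interval R) :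
    ∃ ρ : ℝ, r < ρ ∧ (ρ : EReal) < R := by
  obtain ⟨ρ, h1, h2⟩ := EReal.lt_iff_exists_real_btwn.1 h.2
  exact ⟨ρ, by exact_mod_cast h1, h2⟩

lemma SolvesRadial.isRadialFlow {d : ℝ} {R : EReal} {f : ℝ → ℝ} (h : SolvesRadial d R f) :
    IsRadialFlow d (fun z => 1 - z ^ 2) (interval R) f (fun r => r * deriv f r) := by
  intro r hr
  have hr0 : r ≠ 0 := (ne_of_gt hr.1 : r ≠ 0)
  have ho := isOpen_interval R
  have h2 : ContDiffOn ℝ (1 + 1) f (interval R) := h.2.1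
  rw [contDiffOn_succ_iff_deriv_of_isOpen ho] at h2
  have hf : DifferentiableAt ℝ f r := h2.1.differentiableAt (ho.mem_nhds hr)
  have hf' : DifferentiableAt ℝ (deriv f) r :=
    (h2.2.2.differentiableOn one_ne_zero).differentiableAt (ho.mem_nhds hr)
  refine ⟨by simpa [hr0] using hf.hasDerivAt, ?_⟩
  convert! (hasDerivAt_id r).mul hf'.hasDerivAt using 1
  have := h.2.2 r hr
  simp only [id]
  field_simp at this ⊢
  linear_combination -this

lemma IsRadialFlow.solvesRadial {d : ℝ} {R : EReal} {f p : ℝ → ℝ} (hR : 0 < R)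
    (h : IsRadialFlow d (fun z => 1 - z ^ 2) (interval R) f p) : SolvesRadial d R f := by
  have ho := isOpen_interval R
  have hfc : ContinuousOn f (interval R) := fun r hr => (h r hr).1.continuousAt.continuousWithinAt
  have hpc : ContinuousOn p (interval R) := fun r hr => (h r hr).2.continuousAt.continuousWithinAt
  have hne : ∀ r ∈ interval R, r ≠ 0 := fun r hr => (ne_of_gt hr.1 : r ≠ 0)
  have hdf : EqOn (deriv f) (fun r => p r / r) (interval R) := fun r hr => (h r hr).1.deriv
  have hdp : EqOn (deriv p) (fun r => d ^ 2 * f r / r - r * (f r * (1 - f r ^ 2))) (interval R) :=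
    fun r hr => (h r hr).2.deriv
  have hp1 : ContDiffOn ℝ 1 p (interval R) := by
    rw [← zero_add (1 : WithTop ℕ∞), contDiffOn_succ_iff_deriv_of_isOpen ho]
    refine ⟨fun r hr => (h r hr).2.differentiableAt.differentiableWithinAt, by simp, ?_⟩
    rw [contDiffOn_zero]
    refine ContinuousOn.congr ?_ hdp
    exact ((continuousOn_const.mul hfc).div continuousOn_id hne).sub
      (continuousOn_id.mul (hfc.mul (continuousOn_const.sub (hfc.pow 2))))
  refine ⟨hR, ?_, fun r hr => ?_⟩
  · rw [← one_add_one_eq_two, contDiffOn_succ_iff_deriv_of_isOpen ho]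
    refine ⟨fun r hr => (h r hr).1.differentiableAt.differentiableWithinAt, by simp, ?_⟩
    exact (hp1.div contDiffOn_id hne).congr hdf
  · have e : deriv f =ᶠ[𝓝 r] fun r => p r / r := hdf.eventuallyEq_of_mem (ho.mem_nhds hr)
    have h2 := ((h r hr).2.div (hasDerivAt_id r) (hne r hr)).deriv
    rw [e.deriv_eq, hdf hr]
    have h3 : deriv (fun r => p r / r) r = _ := h2
    rw [h3]
    have := hne r hr
    simp only [id]
    field_simp
    ring

/-- Every solution with `r^{-d} f(r) → a` satisfies the integral equation. The functions
`r^{-d}(p + d f) + ∫₀ʳ t h` and `r^d (p - d f) + ∫₀ʳ t^{2d+1} h` are constant, and the behaviour of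
`f` at `0` forces these constants to be `2da` and `0`. -/
lemma eq_sub_potential_of_hasDerivAt {d a ρ : ℝ} (hd : 0 < d) {f p h : ℝ → ℝ}
    (hf : ∀ r ∈ Ioo 0 ρ, HasDerivAt f (p r / r) r)
    (hp : ∀ r ∈ Ioo 0 ρ, HasDerivAt p (d ^ 2 * f r / r - r * (r ^ d * h r)) r)
    (hh : Continuous h) (hlim : Tendsto (fun r => r ^ (-d) * f r) (𝓝[>] 0) (𝓝 a)) :
    ∀ r ∈ Ioo 0 ρ, r ^ (-d) * f r = a - potential d h r := by
  intro r₀ hr₀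
  have hρ : 0 < ρ := hr₀.1.trans hr₀.2
  have hnhds : Ioo 0 ρ ∈ 𝓝[>] (0 : ℝ) := Ioo_mem_nhdsGT hρ
  let x : ℝ → ℝ := fun r => r ^ (-d) * (p r + d * f r) + lowMoment h r
  let y : ℝ → ℝ := fun r => r ^ d * (p r - d * f r) + highMoment d h r
  have hx : ∀ r ∈ Ioo 0 ρ, HasDerivAt x 0 r := by
    intro r hr
    have h2 := Real.hasDerivAt_rpow_const (x := r) (p := -d) (Or.inl hr.1.ne')
    rw [Real.rpow_sub_one hr.1.ne'] at h2
    convert! (h2.mul ((hp r hr).add ((hf r hr).const_mul d))).add (hasDerivAt_lowMoment hh r) using 1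
    have hXY := rpow_neg_mul_rpow hr.1 d
    have := hr.1.ne'
    simp only [Pi.add_apply]
    field_simp
    linear_combination (r ^ 2 * h r) * hXY
  have hy : ∀ r ∈ Ioo 0 ρ, HasDerivAt y 0 r := by
    intro r hr
    have h2 := Real.hasDerivAt_rpow_const (x := r) (p := d) (Or.inl hr.1.ne')
    rw [Real.rpow_sub_one hr.1.ne'] at h2
    have h4 := hasDerivAt_highMoment hd hh r
    rw [rpow_two_mul_add_one hr.1] at h4
    convert! (h2.mul ((hp r hr).sub ((hf r hr).const_mul d))).add h4 using 1
    have := hr.1.ne'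
    simp only [Pi.sub_apply]
    field_simp
    ring
  have hconst : ∀ z : ℝ → ℝ, (∀ r ∈ Ioo 0 ρ, HasDerivAt z 0 r) → ∀ r ∈ Ioo 0 ρ, z r = z r₀ :=
    fun z hz r hr => (convex_Ioo 0 ρ).is_const_of_fderivWithin_eq_zero
      (fun s hs => (hz s hs).differentiableAt.differentiableWithinAt) (fun s hs => by
        rw [fderivWithin_of_isOpen isOpen_Ioo hs]
        have := (hz s hs).hasFDerivAt.fderiv
        rw [this]; ext; simp) hr hr₀
  have hx' := hconst x hx
  have hy' := hconst y hy
  have hlow : Tendsto (lowMoment h) (𝓝[>] 0) (𝓝 0) := by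
    have := (hasDerivAt_lowMoment hh 0).continuousAt.tendsto.mono_left
      (nhdsWithin_le_nhds (s := Ioi (0 : ℝ)))
    simpa [lowMoment] using this
  have hhigh : Tendsto (highMoment d h) (𝓝[>] 0) (𝓝 0) := by
    have := (hasDerivAt_highMoment hd hh 0).continuousAt.tendsto.mono_left
      (nhdsWithin_le_nhds (s := Ioi (0 : ℝ)))
    simpa [highMoment] using this
  have hrd : Tendsto (fun r : ℝ => r ^ d) (𝓝[>] 0) (𝓝 0) := by
    have := (Real.continuous_rpow_const hd.le).tendsto (0 : ℝ) |>.mono_left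
      (nhdsWithin_le_nhds (s := Ioi (0 : ℝ)))
    rwa [Real.zero_rpow hd.ne'] at this
  -- `x` and `y` determine `f`: without the moments, `2 d f = r^d x - r^{-d} y`
  have rel : ∀ r ∈ Ioo 0 ρ, 2 * d * (r ^ (-d) * f r)
      = x r₀ - lowMoment h r - r ^ (-d) * r ^ (-d) * (y r₀ - highMoment d h r) := by
    intro r hr
    rw [← hx' r hr, ← hy' r hr]
    have hXY := rpow_neg_mul_rpow hr.1 d
    simp only [x, y]
    linear_combination (-(r ^ (-d) * (d * f r - p r))) * hXY
  have hy0 : y r₀ = 0 := by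
    have l1 : Tendsto (fun r => r ^ d * r ^ d * (x r₀ - lowMoment h r - 2 * d * (r ^ (-d) * f r))
        + highMoment d h r) (𝓝[>] 0) (𝓝 (0 * 0 * (x r₀ - 0 - 2 * d * a) + 0)) :=
      ((hrd.mul hrd).mul ((hlow.const_sub _).sub (hlim.const_mul _))).add hhigh
    have l2 : Tendsto (fun _ : ℝ => y r₀) (𝓝[>] 0) (𝓝 (0 * 0 * (x r₀ - 0 - 2 * d * a) + 0)) := by
      refine l1.congr' ?_
      filter_upwards [hnhds] with r hr
      rw [rel r hr]
      have hXY := rpow_neg_mul_rpow hr.1 d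
      linear_combination ((y r₀ - highMoment d h r) * (r ^ (-d) * r ^ d + 1)) * hXY
    simpa using tendsto_nhds_unique tendsto_const_nhds l2
  rw [hy0] at rel
  have hx0 : x r₀ = 2 * d * a := by
    have l1 : Tendsto (fun r => 2 * d * (r ^ (-d) * f r + potential d h r)) (𝓝[>] 0)
        (𝓝 (2 * d * (a + 0))) := by
      refine (hlim.add ?_).const_mul _
      have := (continuous_potential hd hh).tendsto 0 |>.mono_left
        (nhdsWithin_le_nhds (s := Ioi (0 : ℝ)))
      simpa [potential] using this
    have l2 : Tendsto (fun _ : ℝ => x r₀) (𝓝[>] 0) (𝓝 (2 * d * (a + 0))) := by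
      refine l1.congr' ?_
      filter_upwards [hnhds] with r hr
      rw [mul_add, rel r hr, potential_eq_moments hd hh hr.1]
      field_simp
      ring
    simpa using tendsto_nhds_unique tendsto_const_nhds l2
  have := rel r₀ hr₀
  rw [hx0] at this
  rw [potential_eq_moments hd hh hr₀.1]
  field_simp
  linarith

/-- Uniqueness for the integral equation, by Grönwall's lemma. -/
lemma eqOn_of_eq_sub_potential {d a ρ L : ℝ} (hd : 0 < d) (hL : 0 < L) {g₁ g₂ h₁ h₂ : ℝ → ℝ}
    (hg₁ : Continuous g₁) (hg₂ : Continuous g₂) (hh₁ : Continuous h₁) (hh₂ : Continuous h₂)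
    (e₁ : ∀ r ∈ Icc 0 ρ, g₁ r = a - potential d h₁ r)
    (e₂ : ∀ r ∈ Icc 0 ρ, g₂ r = a - potential d h₂ r)
    (hLip : ∀ t ∈ Icc 0 ρ, |h₁ t - h₂ t| ≤ L * |g₁ t - g₂ t|) : EqOn g₁ g₂ (Icc 0 ρ) := by
  intro r hr
  have hρ : 0 ≤ ρ := hr.1.trans hr.2
  have key := le_mul_exp_of_le_add_integral (u := fun t => |g₁ t - g₂ t|)
    (by fun_prop) (fun t => abs_nonneg _) (e := 0) (ρ := ρ) (C := ρ / (2 * d) * L + 1)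
    (by positivity) (by
      intro r hr
      have h1 := abs_potential_le_mul_integral hd (ρ := ρ) (h := fun t => h₁ t - h₂ t)
        (k := fun t => L * |g₁ t - g₂ t|) (by fun_prop) hr.1 hr.2
        (fun t ht => hLip t ⟨ht.1, ht.2.trans hr.2⟩)
      rw [← potential_sub hd hh₁ hh₂, intervalIntegral.integral_const_mul] at h1
      have hI : 0 ≤ ∫ t in (0 : ℝ)..r, |g₁ t - g₂ t| :=
        intervalIntegral.integral_nonneg hr.1 fun t _ => abs_nonneg _
      rw [e₁ r hr, e₂ r hr, abs_sub_comm]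
      have e : a - potential d h₂ r - (a - potential d h₁ r)
        = potential d h₁ r - potential d h₂ r := by ring
      rw [e, add_mul, one_mul, mul_assoc]
      linarith) r hr
  rw [zero_mul] at key
  exact sub_eq_zero.1 (abs_eq_zero.1 (le_antisymm key (abs_nonneg _)))

/-- A solution defined past `ρ` has, on `[0, ρ[`, a continuous profile solving the integral
equation. -/
lemma IsSolutionFromZero.exists_profile {d a ρ : ℝ} (hd : 0 < d) (ha : a ≠ 0) {R : EReal}
    {f : ℝ → ℝ} (h : IsSolutionFromZero d a R f) (hρ : 0 < ρ) (hρR : (ρ : EReal) < R) :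
    ∃ g : ℝ → ℝ, Continuous g ∧ (∀ t ∈ Ioc 0 ρ, t ^ d * g t = f t) ∧
      ∀ r ∈ Ico 0 ρ, g r = a - potential d (fun t => g t * (1 - (t ^ d * g t) ^ 2)) r := by
  have hflow := h.1.isRadialFlow
  have hlim : Tendsto (fun r => r ^ (-d) * f r) (𝓝[>] 0) (𝓝 a) := by
    have := h.2.const_mul a
    rw [mul_one] at this
    refine this.congr fun r => ?_
    field_simp
  have hsub := Ioc_subset_interval hρR
  let g₀ : ℝ → ℝ := Function.update (fun t => t ^ (-d) * f t) 0 a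
  have hg₀ne : ∀ t, t ≠ 0 → g₀ t = t ^ (-d) * f t := fun t ht => Function.update_of_ne ht _ _
  have hg₀c : ContinuousOn g₀ (Icc 0 ρ) := by
    intro t ht
    rcases eq_or_lt_of_le ht.1 with rfl | ht0
    · refine continuousWithinAt_update_same.2 (hlim.mono_left ?_)
      exact nhdsWithin_mono _ fun s hs => lt_of_le_of_ne hs.1.1 (Ne.symm hs.2)
    · have : ContinuousAt (fun t => t ^ (-d) * f t) t :=
        (Real.continuousAt_rpow_const _ _ (Or.inl ht0.ne')).mul
          (hflow t (hsub ⟨ht0, ht.2⟩)).1.continuousAt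
      refine (this.congr ?_).continuousWithinAt
      filter_upwards [lt_mem_nhds ht0] with s hs using (hg₀ne s hs.ne').symm
  let g : ℝ → ℝ := IccExtend hρ.le ((Icc 0 ρ).domRestrict g₀)
  have hgc : Continuous g := (continuousOn_iff_continuous_domRestrict.1 hg₀c).Icc_extend'
  have hgg : ∀ t ∈ Icc 0 ρ, g t = g₀ t := fun t ht => IccExtend_of_mem _ _ ht
  have hgf : ∀ t ∈ Ioc 0 ρ, g t = t ^ (-d) * f t := fun t ht => by
    rw [hgg t ⟨ht.1.le, ht.2⟩, hg₀ne t ht.1.ne']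
  have hgf' : ∀ t ∈ Ioc 0 ρ, t ^ d * g t = f t := fun t ht => by
    rw [hgf t ht, ← mul_assoc, mul_comm (t ^ d), rpow_neg_mul_rpow ht.1, one_mul]
  have hhc : Continuous fun t => g t * (1 - (t ^ d * g t) ^ 2) := by
    have : Continuous fun t : ℝ => t ^ d := Real.continuous_rpow_const hd.le
    fun_prop
  refine ⟨g, hgc, hgf', fun r hr => ?_⟩
  rcases eq_or_lt_of_le hr.1 with rfl | hr0
  · rw [hgg 0 ⟨le_rfl, hρ.le⟩]; simp [potential, g₀]
  · rw [hgf r ⟨hr0, hr.2.le⟩]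
    refine eq_sub_potential_of_hasDerivAt hd (ρ := ρ) (p := fun r => r * deriv f r)
      (fun s hs => (hflow s (hsub ⟨hs.1, hs.2.le⟩)).1)
      (fun s hs => ?_) hhc hlim r ⟨hr0, hr.2⟩
    have h2 := (hflow s (hsub ⟨hs.1, hs.2.le⟩)).2
    rw [← mul_assoc (s ^ d), hgf' s ⟨hs.1, hs.2.le⟩]
    exact h2

lemma IsSolutionFromZero.eq {d a : ℝ} (hd : 0 < d) (ha : a ≠ 0) {R R' : EReal} {f h : ℝ → ℝ}
    (hf : IsSolutionFromZero d a R f) (hh : IsSolutionFromZero d a R' h) {r : ℝ}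
    (hr : r ∈ interval R) (hr' : r ∈ interval R') : f r = h r := by
  obtain ⟨ρ, hρ, hρR⟩ := exists_lt_of_mem_interval (R := min R R') (r := r)
    ⟨hr.1, lt_min hr.2 hr'.2⟩
  have hr0 : 0 < r := hr.1
  have hρ0 : 0 < ρ := hr0.trans hρ
  obtain ⟨g₁, hg₁, hgf₁, e₁⟩ := hf.exists_profile hd ha hρ0 (hρR.trans_le (min_le_left _ _))
  obtain ⟨g₂, hg₂, hgf₂, e₂⟩ := hh.exists_profile hd ha hρ0 (hρR.trans_le (min_le_right _ _))
  have hpc : Continuous fun t : ℝ => t ^ d := Real.continuous_rpow_const hd.le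
  -- a Lipschitz constant of the nonlinearity along the two profiles
  obtain ⟨L, hL⟩ := isCompact_Icc.exists_bound_of_continuousOn (s := Icc 0 r)
    (f := fun t => 1 - (t ^ d) ^ 2 * (g₁ t ^ 2 + g₁ t * g₂ t + g₂ t ^ 2)) (by fun_prop)
  have hL0 : 0 ≤ L := (norm_nonneg _).trans (hL 0 ⟨le_rfl, hr0.le⟩)
  have heq := eqOn_of_eq_sub_potential (ρ := r) (L := L + 1) hd (by linarith) hg₁ hg₂
    (h₁ := fun t => g₁ t * (1 - (t ^ d * g₁ t) ^ 2))
    (h₂ := fun t => g₂ t * (1 - (t ^ d * g₂ t) ^ 2)) (by fun_prop) (by fun_prop)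
    (fun s hs => e₁ s ⟨hs.1, hs.2.trans_lt hρ⟩) (fun s hs => e₂ s ⟨hs.1, hs.2.trans_lt hρ⟩)
    (fun t ht => by
      have e : g₁ t * (1 - (t ^ d * g₁ t) ^ 2) - g₂ t * (1 - (t ^ d * g₂ t) ^ 2)
        = (1 - (t ^ d) ^ 2 * (g₁ t ^ 2 + g₁ t * g₂ t + g₂ t ^ 2)) * (g₁ t - g₂ t) := by ring
      rw [e, abs_mul]
      exact mul_le_mul_of_nonneg_right ((hL t ht).trans (by linarith)) (abs_nonneg _))
  rw [← hgf₁ r ⟨hr0, hρ.le⟩, ← hgf₂ r ⟨hr0, hρ.le⟩, heq ⟨hr0.le, le_rfl⟩]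

/-! ### The global solution of the truncated equation -/

/-- The solution of the truncated equation with `f ~ a r^d` at `0`. -/
noncomputable def solution (d a r : ℝ) : ℝ := r ^ d * profile d a r

/-- The function `r f'` attached to `f = solution d a`. -/
noncomputable def momentum (d a r : ℝ) : ℝ :=
  r ^ d * (d * a - lowMoment (source d (profile d a)) r / 2)
    - r ^ (-d) * highMoment d (source d (profile d a)) r / 2

lemma solution_eq_moments {d : ℝ} (hd : 0 < d) (a : ℝ) {r : ℝ} (hr : 0 < r) :
    solution d a r = r ^ d * (a - lowMoment (source d (profile d a)) r / (2 * d))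
      + r ^ (-d) * highMoment d (source d (profile d a)) r / (2 * d) := by
  rw [solution, profile_eq hd, potential_eq_moments hd (continuous_source_profile hd a) hr]
  have hXY := rpow_neg_mul_rpow hr d
  field_simp
  linear_combination (r ^ (-d) * highMoment d (source d (profile d a)) r) * hXY

lemma isRadialFlow_solution {d : ℝ} (hd : 0 < d) (a : ℝ) :
    IsRadialFlow d cutoff (Ioi 0) (solution d a) (momentum d a) := by
  intro r hr
  have h := hasDerivAt_variation hd (continuous_source_profile hd a) a hr
  refine ⟨h.1.congr_of_eventuallyEq ?_, ?_⟩
  · filter_upwards [lt_mem_nhds hr] with s hs using solution_eq_moments hd a hs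
  have h2 := h.2
  rw [← solution_eq_moments hd a hr] at h2
  have e2 : solution d a r * cutoff (solution d a r)
      = r ^ d * source d (profile d a) r := by
    simp only [solution, source]; ring
  rw [e2]
  exact h2

lemma continuous_solution {d : ℝ} (hd : 0 < d) (a : ℝ) : Continuous (solution d a) :=
  (Real.continuous_rpow_const hd.le).mul (continuous_profile hd a)

lemma solution_zero {d : ℝ} (hd : 0 < d) (a : ℝ) : solution d a 0 = 0 := by
  simp [solution, Real.zero_rpow hd.ne']

lemma isSolutionFromZero_solution {d a : ℝ} (hd : 0 < d) (ha : a ≠ 0) {R : EReal} (hR : 0 < R)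
    (h : ∀ r ∈ interval R, |solution d a r| ≤ 1) : IsSolutionFromZero d a R (solution d a) := by
  refine ⟨IsRadialFlow.solvesRadial hR (p := momentum d a) fun r hr => ?_, ?_⟩
  · have := isRadialFlow_solution hd a r hr.1
    rwa [cutoff_of_abs_le (h r hr)] at this
  · have h1 : Tendsto (fun r => 1 / a * profile d a r) (𝓝[>] 0) (𝓝 (1 / a * profile d a 0)) :=
      ((continuous_profile hd a).tendsto 0 |>.mono_left nhdsWithin_le_nhds).const_mul _
    rw [profile_zero hd, one_div_mul_cancel ha] at h1
    refine h1.congr' ?_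
    filter_upwards [self_mem_nhdsWithin] with r hr
    have hXY := rpow_neg_mul_rpow (show 0 < r from hr) d
    rw [solution]
    linear_combination (-(1 / a * profile d a r)) * hXY

lemma IsSolutionFromZero.eq_solution {d a : ℝ} (hd : 0 < d) (ha : a ≠ 0) {R : EReal}
    {f : ℝ → ℝ} (hf : IsSolutionFromZero d a R f) (h : ∀ r ∈ interval R, |f r| ≤ 1) {r : ℝ}
    (hr : r ∈ interval R) : f r = solution d a r := by
  obtain ⟨ρ, hρ, hρR⟩ := exists_lt_of_mem_interval hr
  have hr0 : 0 < r := hr.1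
  obtain ⟨g, hg, hgf, e⟩ := hf.exists_profile hd ha (hr0.trans hρ) hρR
  have hpc : Continuous fun t : ℝ => t ^ d := Real.continuous_rpow_const hd.le
  have heq := eqOn_of_eq_sub_potential (ρ := r) (L := 2) hd two_pos hg (continuous_profile hd a)
    (h₁ := fun t => g t * (1 - (t ^ d * g t) ^ 2)) (by fun_prop) (continuous_source_profile hd a)
    (fun s hs => e s ⟨hs.1, hs.2.trans_lt hρ⟩) (fun s _ => profile_eq hd a s)
    (fun t ht => by
      have hle : |t ^ d * g t| ≤ 1 := by
        rcases eq_or_lt_of_le ht.1 with rfl | ht0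
        · simp [Real.zero_rpow hd.ne']
        · rw [hgf t ⟨ht0, ht.2.trans hρ.le⟩]
          exact h t (Ioc_subset_interval hρR ⟨ht0, ht.2.trans hρ.le⟩)
      rw [← cutoff_of_abs_le hle]
      exact abs_source_sub_le d g (profile d a) t)
  rw [← hgf r ⟨hr0, hρ.le⟩, heq ⟨hr0.le, le_rfl⟩, solution]

/-! ### The maximal solution -/

/-- Near `0` the truncated solution is small, so the truncation is not active. -/
lemma exists_isSolutionFromZero {d a : ℝ} (hd : 0 < d) (ha : a ≠ 0) :
    ∃ (R : EReal) (f : ℝ → ℝ), IsSolutionFromZero d a R f := by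
  have hc := (continuous_solution hd a).abs.tendsto 0
  rw [solution_zero hd, abs_zero] at hc
  obtain ⟨ρ, hρ, h⟩ := Metric.eventually_nhds_iff.1 (hc.eventually (gt_mem_nhds zero_lt_one))
  refine ⟨ρ, solution d a, isSolutionFromZero_solution hd ha (by exact_mod_cast hρ) fun r hr => ?_⟩
  rw [interval_coe] at hr
  exact (h (by rw [Real.dist_eq, sub_zero, abs_of_pos hr.1]; exact hr.2)).le

/-- Being a solution is local in `r`; the behaviour at `0` is that of one local solution. -/
lemma IsSolutionFromZero.of_eqOn_locally {d a : ℝ} {R : EReal} {f : ℝ → ℝ}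
    (hne : ∃ (S : EReal) (h : ℝ → ℝ), IsSolutionFromZero d a S h ∧ EqOn f h (interval S))
    (hR : 0 < R)
    (hloc : ∀ r ∈ interval R, ∃ (S : EReal) (h : ℝ → ℝ), IsSolutionFromZero d a S h ∧
      r ∈ interval S ∧ EqOn f h (interval S)) : IsSolutionFromZero d a R f := by
  have hev : ∀ r ∈ interval R, ∃ (S : EReal) (h : ℝ → ℝ), IsSolutionFromZero d a S h ∧
      r ∈ interval S ∧ f =ᶠ[𝓝 r] h := by
    intro r hr
    obtain ⟨S, h, h1, h2, h3⟩ := hloc r hr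
    exact ⟨S, h, h1, h2, h3.eventuallyEq_of_mem ((isOpen_interval S).mem_nhds h2)⟩
  refine ⟨⟨hR, fun r hr => ?_, fun r hr => ?_⟩, ?_⟩
  · obtain ⟨S, h, h1, h2, h3⟩ := hev r hr
    have := h1.1.2.1.contDiffAt ((isOpen_interval S).mem_nhds h2)
    exact (this.congr_of_eventuallyEq h3).contDiffWithinAt
  · obtain ⟨S, h, h1, h2, h3⟩ := hev r hr
    rw [h3.deriv.deriv_eq, h3.deriv_eq, h3.eq_of_nhds]
    exact h1.1.2.2 r h2
  · obtain ⟨S, h, h1, h3⟩ := hne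
    refine h1.2.congr' ?_
    obtain ⟨ρ, hρ, hρS⟩ := EReal.lt_iff_exists_real_btwn.1 h1.1.1
    have hρ0 : 0 < ρ := by exact_mod_cast hρ
    filter_upwards [Ioo_mem_nhdsGT hρ0] with r hr
    rw [h3 (Ioc_subset_interval hρS ⟨hr.1, hr.2.le⟩)]

/-- Solutions with the same `a` agree where both are defined, so they glue to a largest one. -/
theorem exists_maximal_solution {d a : ℝ} (hd : 0 < d) (ha : 0 < a) :
    ∃ (R : EReal) (f : ℝ → ℝ), IsSolutionFromZero d a R f ∧
      ∀ (R' : EReal) (h : ℝ → ℝ), IsSolutionFromZero d a R' h →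
        R' ≤ R ∧ EqOn h f (interval R') := by
  classical
  let Dom : Set EReal := {S | ∃ h, IsSolutionFromZero d a S h}
  let f : ℝ → ℝ := fun r => if hr : ∃ (S : EReal) (h : ℝ → ℝ), IsSolutionFromZero d a S h ∧
    r ∈ interval S then hr.choose_spec.choose r else 0
  have hf : ∀ (S : EReal) (h : ℝ → ℝ), IsSolutionFromZero d a S h → EqOn f h (interval S) := by
    intro S h hS r hr
    have hex : ∃ (S : EReal) (h : ℝ → ℝ), IsSolutionFromZero d a S h ∧ r ∈ interval S :=
      ⟨S, h, hS, hr⟩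
    have e : f r = hex.choose_spec.choose r := dif_pos hex
    rw [e]
    have hs := hex.choose_spec.choose_spec
    exact hs.1.eq hd ha.ne' hS hs.2 hr
  obtain ⟨S₀, h₀, hS₀⟩ := exists_isSolutionFromZero hd ha.ne'
  refine ⟨sSup Dom, f, ?_, fun R' h hR' => ⟨le_sSup ⟨h, hR'⟩, (hf R' h hR').symm⟩⟩
  refine IsSolutionFromZero.of_eqOn_locally ⟨S₀, h₀, hS₀, hf S₀ h₀ hS₀⟩
    (hS₀.1.1.trans_le (le_sSup ⟨h₀, hS₀⟩)) fun r hr => ?_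
  obtain ⟨S, ⟨h, hS⟩, hrS⟩ := lt_sSup_iff.1 hr.2
  exact ⟨S, h, hS, ⟨hr.1, hrS⟩, hf S h hS⟩

/-! ### Qualitative properties of the truncated solutions -/

/-- Integration of `r u' ≤ - c`. -/
lemma le_sub_mul_log {u u' : ℝ → ℝ} {c r₀ r₁ : ℝ} (h0 : 0 < r₀) (h01 : r₀ ≤ r₁)
    (hu : ∀ r ∈ Icc r₀ r₁, HasDerivAt u (u' r) r) (hle : ∀ r ∈ Icc r₀ r₁, u' r ≤ -(c / r)) :
    u r₁ ≤ u r₀ - c * Real.log (r₁ / r₀) := by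
  have hder : ∀ r ∈ Icc r₀ r₁, HasDerivAt (fun r => u r + c * Real.log r) (u' r + c * r⁻¹) r :=
    fun r hr => (hu r hr).add ((Real.hasDerivAt_log (h0.trans_le hr.1).ne').const_mul c)
  have hanti : AntitoneOn (fun r => u r + c * Real.log r) (Icc r₀ r₁) := by
    refine antitoneOn_of_deriv_nonpos (convex_Icc _ _)
      (fun r hr => (hder r hr).continuousAt.continuousWithinAt) (fun r hr => ?_) fun r hr => ?_
    · rw [interior_Icc] at hr
      exact (hder r (Ioo_subset_Icc_self hr)).differentiableAt.differentiableWithinAt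
    · rw [interior_Icc] at hr
      rw [(hder r (Ioo_subset_Icc_self hr)).deriv, ← div_eq_mul_inv]
      linarith [hle r (Ioo_subset_Icc_self hr)]
  have := hanti ⟨le_rfl, h01⟩ ⟨h01, le_rfl⟩ h01
  simp only at this
  rw [Real.log_div (h0.trans_le h01).ne' h0.ne']
  linarith

lemma profile_eq_rpow_neg_mul (d a : ℝ) {r : ℝ} (hr : 0 < r) :
    profile d a r = r ^ (-d) * solution d a r := by
  rw [solution, ← mul_assoc, rpow_neg_mul_rpow hr, one_mul]

lemma solution_pos_iff {d a r : ℝ} (hr : 0 < r) : 0 < solution d a r ↔ 0 < profile d a r :=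
  mul_pos_iff_of_pos_left (Real.rpow_pos_of_pos hr d)

lemma profile_pos {d a r : ℝ} (hd : 0 < d) (ha : 0 < a)
    (h : ∀ t ∈ Ioc 0 r, 0 < solution d a t) : ∀ t ∈ Icc 0 r, 0 < profile d a t := by
  intro t ht
  rcases eq_or_lt_of_le ht.1 with rfl | h0
  · rwa [profile_zero hd]
  · exact (solution_pos_iff h0).1 (h t ⟨h0, ht.2⟩)

lemma source_nonneg {d a r : ℝ} (h : 0 ≤ profile d a r) : 0 ≤ source d (profile d a) r :=
  mul_nonneg h (cutoff_nonneg _)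

lemma profile_le {d a r : ℝ} (hd : 0 < d) (hr : 0 ≤ r) (h : ∀ t ∈ Icc 0 r, 0 ≤ profile d a t) :
    profile d a r ≤ a := by
  rw [profile_eq hd]
  linarith [potential_nonneg hd hr fun t ht => source_nonneg (h t ht)]

/-- While `f ≥ 0`, the profile `r^{-d} f` is nonincreasing, i.e. `r f' ≤ d f`. -/
lemma momentum_le {d a r : ℝ} (hd : 0 < d) (hr : 0 < r)
    (h : ∀ t ∈ Icc 0 r, 0 ≤ profile d a t) : momentum d a r ≤ d * solution d a r := by
  have h1 : 0 ≤ highMoment d (source d (profile d a)) r :=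
    intervalIntegral.integral_nonneg hr.le fun t ht =>
      mul_nonneg (Real.rpow_nonneg ht.1 _) (source_nonneg (h t ht))
  have h2 := mul_nonneg (Real.rpow_nonneg hr.le (-d)) h1
  have e : d * solution d a r = momentum d a r
      + r ^ (-d) * highMoment d (source d (profile d a)) r := by
    rw [solution_eq_moments hd a hr, momentum]; field_simp; ring
  linarith

lemma hasDerivAt_solution {d : ℝ} (hd : 0 < d) (a : ℝ) {r : ℝ} (hr : 0 < r) :
    HasDerivAt (solution d a) (momentum d a r / r) r := (isRadialFlow_solution hd a r hr).1

lemma hasDerivAt_momentum {d : ℝ} (hd : 0 < d) (a : ℝ) {r : ℝ} (hr : 0 < r) :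
    HasDerivAt (momentum d a)
      (d ^ 2 * solution d a r / r - r * (solution d a r * cutoff (solution d a r))) r :=
  (isRadialFlow_solution hd a r hr).2

lemma continuousOn_momentum {d : ℝ} (hd : 0 < d) (a : ℝ) : ContinuousOn (momentum d a) (Ioi 0) :=
  fun _ hr => (hasDerivAt_momentum hd a hr).continuousAt.continuousWithinAt

lemma tendsto_rpow_neg_mul_momentum {d : ℝ} (hd : 0 < d) (a : ℝ) :
    Tendsto (fun r => r ^ (-d) * momentum d a r) (𝓝[>] 0) (𝓝 (d * a)) := by
  have hs := continuous_source_profile hd a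
  have h1 : Tendsto (fun r => d * a - lowMoment (source d (profile d a)) r
      + d * potential d (source d (profile d a)) r) (𝓝[>] 0) (𝓝 (d * a - 0 + d * 0)) := by
    refine (tendsto_const_nhds.sub ?_).add (Tendsto.const_mul _ ?_)
    · have := (hasDerivAt_lowMoment hs 0).continuousAt.tendsto.mono_left
        (nhdsWithin_le_nhds (s := Ioi (0 : ℝ)))
      simpa [lowMoment] using this
    · have := (continuous_potential hd hs).tendsto 0 |>.mono_left
        (nhdsWithin_le_nhds (s := Ioi (0 : ℝ)))
      simpa [potential] using this
  rw [sub_zero, mul_zero, add_zero] at h1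
  refine h1.congr' ?_
  filter_upwards [self_mem_nhdsWithin] with r hr
  have hXY := rpow_neg_mul_rpow (show 0 < r from hr) d
  rw [potential_eq_moments hd hs hr, momentum]
  field_simp
  linear_combination (-(2 * d * a - lowMoment (source d (profile d a)) r)) * hXY

lemma exists_pos_near_zero {d a : ℝ} (hd : 0 < d) (ha : 0 < a) :
    ∃ ρ > 0, ∀ r ∈ Ioc 0 ρ, 0 < solution d a r ∧ 0 < momentum d a r := by
  have h1 : ∀ᶠ r in 𝓝[>] (0 : ℝ), 0 < profile d a r := by
    have := (continuous_profile hd a).tendsto 0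
    rw [profile_zero hd] at this
    exact (this.eventually (lt_mem_nhds ha)).filter_mono nhdsWithin_le_nhds
  have h2 := (tendsto_rpow_neg_mul_momentum hd a).eventually (lt_mem_nhds (mul_pos hd ha))
  obtain ⟨ρ, hρ, h⟩ := mem_nhdsGT_iff_exists_Ioc_subset.1
    ((h1.and h2).and (self_mem_nhdsWithin (s := Ioi (0 : ℝ))))
  refine ⟨ρ, hρ, fun r hr => ?_⟩
  obtain ⟨⟨h3, h4⟩, h5⟩ := h hr
  exact ⟨(solution_pos_iff h5).2 h3,
    (mul_pos_iff_of_pos_left (Real.rpow_pos_of_pos h5 _)).1 h4⟩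

lemma antitoneOn_solution {d a r s : ℝ} (hd : 0 < d) (hr : 0 < r)
    (h : ∀ t ∈ Ioo r s, momentum d a t ≤ 0) : AntitoneOn (solution d a) (Icc r s) := by
  refine antitoneOn_of_deriv_nonpos (convex_Icc _ _) (continuous_solution hd a).continuousOn
    (fun t ht => ?_) fun t ht => ?_ <;> rw [interior_Icc] at ht
  · exact (hasDerivAt_solution hd a (hr.trans ht.1)).differentiableAt.differentiableWithinAt
  · rw [(hasDerivAt_solution hd a (hr.trans ht.1)).deriv]
    exact div_nonpos_of_nonpos_of_nonneg (h t ht) (hr.trans ht.1).le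

lemma monotoneOn_solution {d a r s : ℝ} (hd : 0 < d) (hr : 0 < r)
    (h : ∀ t ∈ Ioo r s, 0 ≤ momentum d a t) : MonotoneOn (solution d a) (Icc r s) := by
  refine monotoneOn_of_deriv_nonneg (convex_Icc _ _) (continuous_solution hd a).continuousOn
    (fun t ht => ?_) fun t ht => ?_ <;> rw [interior_Icc] at ht
  · exact (hasDerivAt_solution hd a (hr.trans ht.1)).differentiableAt.differentiableWithinAt
  · rw [(hasDerivAt_solution hd a (hr.trans ht.1)).deriv]
    exact div_nonneg (h t ht) (hr.trans ht.1).le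

/-- While `f` decreases, `r² (1 - f²)₊` increases, so `r (r f')' = f (d² - r² (1 - f²)₊)` stays
nonpositive once it is. -/
lemma antitoneOn_momentum {d a r s : ℝ} (hd : 0 < d) (hr : 0 < r)
    (hpos : ∀ t ∈ Ico r s, 0 < solution d a t) (h : ∀ t ∈ Ioo r s, momentum d a t ≤ 0)
    (hk : d ^ 2 ≤ r ^ 2 * cutoff (solution d a r)) : AntitoneOn (momentum d a) (Icc r s) := by
  have hF := antitoneOn_solution hd hr h
  refine antitoneOn_of_deriv_nonpos (convex_Icc _ _)
    ((continuousOn_momentum hd a).mono fun t ht => hr.trans_le ht.1)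
    (fun t ht => ?_) fun t ht => ?_ <;> rw [interior_Icc] at ht
  · exact (hasDerivAt_momentum hd a (hr.trans ht.1)).differentiableAt.differentiableWithinAt
  · rw [(hasDerivAt_momentum hd a (hr.trans ht.1)).deriv]
    have ht0 : 0 < t := hr.trans ht.1
    have hFt := hpos t ⟨ht.1.le, ht.2⟩
    have h1 : cutoff (solution d a r) ≤ cutoff (solution d a t) :=
      cutoff_antitone hFt.le
        (hF ⟨le_rfl, (ht.1.trans ht.2).le⟩ (Ioo_subset_Icc_self ht) ht.1.le)
    have h2 : d ^ 2 ≤ t ^ 2 * cutoff (solution d a t) :=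
      hk.trans (mul_le_mul (pow_le_pow_left₀ hr.le ht.1.le 2) h1 (cutoff_nonneg _) (sq_nonneg t))
    have e : d ^ 2 * solution d a t / t - t * (solution d a t * cutoff (solution d a t))
        = solution d a t / t * (d ^ 2 - t ^ 2 * cutoff (solution d a t)) := by
      field_simp
    rw [e]
    exact mul_nonpos_of_nonneg_of_nonpos (by positivity) (by linarith)

/-- Once a solution turns down, it keeps decreasing as long as it is positive. -/
lemma momentum_le_of_neg {d a ρ r₁ : ℝ} (hd : 0 < d) (ha : 0 < a)
    (hpos : ∀ t ∈ Ioo 0 ρ, 0 < solution d a t) (hr₁ : r₁ ∈ Ioo 0 ρ) (hneg : momentum d a r₁ < 0) :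
    ∀ r ∈ Ico r₁ ρ, momentum d a r ≤ momentum d a r₁ := by
  obtain ⟨δ, hδ, hδpos⟩ := exists_pos_near_zero hd ha
  have hδr : δ < r₁ := lt_of_not_ge fun hle => (hδpos r₁ ⟨hr₁.1, hle⟩).2.not_gt hneg
  have hcont : ContinuousOn (momentum d a) (Icc δ r₁) :=
    (continuousOn_momentum hd a).mono fun t ht => hδ.trans_le ht.1
  -- `r₀` is the last point before `r₁` at which the momentum is nonnegative
  have hcomp : IsCompact (Icc δ r₁ ∩ momentum d a ⁻¹' Ici 0) :=
    isCompact_Icc.of_isClosed_subset (hcont.preimage_isClosed_of_isClosed isClosed_Icc isClosed_Ici)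
      inter_subset_left
  obtain ⟨r₀, ⟨hr₀, hr₀n⟩, hmax⟩ :=
    hcomp.exists_isGreatest ⟨δ, ⟨le_rfl, hδr.le⟩, (hδpos δ ⟨hδ, le_rfl⟩).2.le⟩
  have hr₀n' : 0 ≤ momentum d a r₀ := hr₀n
  have hr₀r₁ : r₀ < r₁ := lt_of_le_of_ne hr₀.2 fun he => by rw [he] at hr₀n'; linarith
  have hr₀0 : 0 < r₀ := hδ.trans_le hr₀.1
  have hbetween : ∀ t ∈ Ioc r₀ r₁, momentum d a t < 0 := fun t ht => lt_of_not_ge fun hge =>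
    ht.1.not_ge (hmax ⟨⟨hr₀.1.trans ht.1.le, ht.2⟩, hge⟩)
  obtain ⟨ξ, hξ, hξe⟩ := exists_hasDerivAt_eq_slope (momentum d a) _ hr₀r₁
    (hcont.mono (Icc_subset_Icc_left hr₀.1))
    (fun t ht => hasDerivAt_momentum hd a (hr₀0.trans ht.1))
  have hξ0 : 0 < ξ := hr₀0.trans hξ.1
  have hFξ := hpos ξ ⟨hξ0, hξ.2.trans hr₁.2⟩
  have hk : d ^ 2 ≤ ξ ^ 2 * cutoff (solution d a ξ) := by
    have hslope : (momentum d a r₁ - momentum d a r₀) / (r₁ - r₀) < 0 :=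
      div_neg_of_neg_of_pos (by linarith) (by linarith)
    rw [← hξe] at hslope
    have e : d ^ 2 * solution d a ξ / ξ - ξ * (solution d a ξ * cutoff (solution d a ξ))
        = solution d a ξ / ξ * (d ^ 2 - ξ ^ 2 * cutoff (solution d a ξ)) := by
      field_simp
    rw [e] at hslope
    have := (pos_iff_neg_of_mul_neg hslope).1 (by positivity)
    linarith
  have hstay : ∀ r ∈ Ico ξ ρ, momentum d a r < 0 := by
    by_contra! hcon
    obtain ⟨r, hr, hrn⟩ := hcon
    have hcont' : ContinuousOn (momentum d a) (Icc ξ r) :=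
      (continuousOn_momentum hd a).mono fun t ht => hξ0.trans_le ht.1
    have hcomp' : IsCompact (Icc ξ r ∩ momentum d a ⁻¹' Ici 0) :=
      isCompact_Icc.of_isClosed_subset
        (hcont'.preimage_isClosed_of_isClosed isClosed_Icc isClosed_Ici) inter_subset_left
    obtain ⟨r₂, ⟨hr₂, hr₂n⟩, hmin⟩ := hcomp'.exists_isLeast ⟨r, ⟨hr.1, le_rfl⟩, hrn⟩
    have hanti := antitoneOn_momentum (s := r₂) hd hξ0
      (fun t ht => hpos t ⟨hξ0.trans_le ht.1, ht.2.trans_le hr₂.2 |>.trans hr.2⟩)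
      (fun t ht => (lt_of_not_ge fun hge =>
        ht.2.not_ge (hmin ⟨⟨ht.1.le, ht.2.le.trans hr₂.2⟩, hge⟩)).le) hk
    have h1 := hanti ⟨le_rfl, hr₂.1⟩ ⟨hr₂.1, le_rfl⟩ hr₂.1
    have h2 : 0 ≤ momentum d a r₂ := hr₂n
    linarith [hbetween ξ ⟨hξ.1, hξ.2.le⟩]
  intro r hr
  refine antitoneOn_momentum (s := r) hd hξ0
      (fun t ht => hpos t ⟨hξ0.trans_le ht.1, ht.2.trans hr.2⟩)
      (fun t ht => (hstay t ⟨ht.1.le, ht.2.trans hr.2⟩).le) hk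
      ⟨hξ.2.le, hr.1⟩ ⟨hξ.2.le.trans hr.1, le_rfl⟩ hr.1

/-- A solution that turns down is below `f(r) - c log(t/r)` afterwards, hence not positive
forever. -/
lemma momentum_nonneg_of_pos {d a : ℝ} (hd : 0 < d) (ha : 0 < a)
    (hpos : ∀ t, 0 < t → 0 < solution d a t) {r : ℝ} (hr : 0 < r) : 0 ≤ momentum d a r := by
  by_contra! hneg
  set c := -momentum d a r with hc
  have hc0 : 0 < c := by linarith
  have hFr := hpos r hr
  set s := r * Real.exp (solution d a r / c) with hs
  have hrs : r ≤ s := le_mul_of_one_le_right hr.le (Real.one_le_exp (by positivity))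
  have h := le_sub_mul_log (c := c) hr hrs
    (fun t ht => hasDerivAt_solution hd a (hr.trans_le ht.1)) (fun t ht => by
      have h1 := momentum_le_of_neg (ρ := t + 1) hd ha (fun u hu => hpos u hu.1)
        ⟨hr, by linarith [ht.1]⟩ hneg t ⟨ht.1, by linarith⟩
      rw [← neg_div]
      exact div_le_div_of_nonneg_right (by linarith) (hr.trans_le ht.1).le)
  have e : s / r = Real.exp (solution d a r / c) := by rw [hs]; field_simp
  rw [e, Real.log_exp, mul_div_cancel₀ _ hc0.ne', sub_self] at h
  exact h.not_gt (hpos s (hr.trans_le hrs))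

/-! ### Comparison of two solutions -/

/-- Sturm type comparison: while positive, solutions with a larger coefficient `b` exceed
`b / a` times the one with coefficient `a`. The Wronskian `f_a r f_b' - f_b r f_a'` is
nondecreasing as long as `f_a ≤ f_b`. -/
theorem mul_solution_le {d a b ρ : ℝ} (hd : 0 < d) (ha : 0 < a) (hab : a < b)
    (hpos : ∀ t ∈ Ioc 0 ρ, 0 < solution d a t) {r : ℝ} (hr : r ∈ Ioc 0 ρ) :
    b / a * solution d a r ≤ solution d b r := by
  have hga := profile_pos hd ha hpos
  let z : ℝ → ℝ := fun t => profile d b t / profile d a t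
  have hzc : ContinuousOn z (Icc 0 ρ) := (continuous_profile hd b).continuousOn.div
    (continuous_profile hd a).continuousOn fun t ht => (hga t ht).ne'
  have hz0 : z 0 = b / a := by simp only [z, profile_zero hd]
  have hba : 1 < b / a := (one_lt_div ha).2 hab
  have hmul : ∀ t ∈ Icc 0 ρ, solution d b t = z t * solution d a t := by
    intro t ht
    have := (hga t ht).ne'
    simp only [z, solution]
    field_simp
  let W : ℝ → ℝ := fun t => solution d a t * momentum d b t - solution d b t * momentum d a t
  have hWder : ∀ t, 0 < t → HasDerivAt W (t * (solution d a t * solution d b t)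
      * (cutoff (solution d a t) - cutoff (solution d b t))) t := by
    intro t ht
    convert! ((hasDerivAt_solution hd a ht).mul (hasDerivAt_momentum hd b ht)).sub
      ((hasDerivAt_solution hd b ht).mul (hasDerivAt_momentum hd a ht)) using 1
    field_simp
    ring
  have hW0 : Tendsto W (𝓝[>] 0) (𝓝 0) := by
    have hF : ∀ c, Tendsto (solution d c) (𝓝[>] 0) (𝓝 0) := fun c => by
      have := (continuous_solution hd c).tendsto 0 |>.mono_left
        (nhdsWithin_le_nhds (s := Ioi (0 : ℝ)))
      rwa [solution_zero hd] at this
    have hP : ∀ c, Tendsto (momentum d c) (𝓝[>] 0) (𝓝 0) := fun c => by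
      have h1 := (Real.continuous_rpow_const hd.le).tendsto (0 : ℝ) |>.mono_left
        (nhdsWithin_le_nhds (s := Ioi (0 : ℝ)))
      rw [Real.zero_rpow hd.ne'] at h1
      have := h1.mul (tendsto_rpow_neg_mul_momentum hd c)
      rw [zero_mul] at this
      refine this.congr' ?_
      filter_upwards [self_mem_nhdsWithin] with t ht
      rw [← mul_assoc, mul_comm (t ^ d), rpow_neg_mul_rpow ht, one_mul]
    simpa using ((hF a).mul (hP b)).sub ((hF b).mul (hP a))
  have hmono : ∀ s ≤ ρ, (∀ t ∈ Ico 0 s, 1 < z t) → MonotoneOn z (Icc 0 s) := by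
    intro s hs hz
    have hWmono : MonotoneOn W (Ioo 0 s) := by
      refine monotoneOn_of_deriv_nonneg (convex_Ioo _ _)
        (fun t ht => (hWder t ht.1).continuousAt.continuousWithinAt) (fun t ht => ?_)
        fun t ht => ?_ <;> rw [interior_Ioo] at ht
      · exact (hWder t ht.1).differentiableAt.differentiableWithinAt
      · rw [(hWder t ht.1).deriv]
        have h1 := hpos t ⟨ht.1, ht.2.le.trans hs⟩
        have h2 : solution d a t ≤ solution d b t := by
          rw [hmul t ⟨ht.1.le, ht.2.le.trans hs⟩]
          exact le_mul_of_one_le_left h1.le (hz t ⟨ht.1.le, ht.2⟩).le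
        have h3 := cutoff_antitone h1.le h2
        have h4 := h1.le.trans h2
        exact mul_nonneg (mul_nonneg ht.1.le (mul_nonneg h1.le h4)) (by linarith)
    have hWnn : ∀ t ∈ Ioo 0 s, 0 ≤ W t := by
      intro t ht
      refine le_of_tendsto hW0 ?_
      filter_upwards [Ioo_mem_nhdsGT ht.1] with u hu
      exact hWmono ⟨hu.1, hu.2.trans ht.2⟩ ht hu.2.le
    have hzder : ∀ t ∈ Ioo 0 s, HasDerivAt z (W t / t / solution d a t ^ 2) t := by
      intro t ht
      have h1 := hpos t ⟨ht.1, ht.2.le.trans hs⟩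
      have h2 := (hasDerivAt_solution hd b ht.1).div (hasDerivAt_solution hd a ht.1) h1.ne'
      have h3 : HasDerivAt (solution d b / solution d a) (W t / t / solution d a t ^ 2) t := by
        convert! h2 using 1
        simp only [W]
        field_simp
      refine h3.congr_of_eventuallyEq ?_
      filter_upwards [Ioo_mem_nhds ht.1 ht.2] with u hu
      rw [Pi.div_apply, hmul u ⟨hu.1.le, hu.2.le.trans hs⟩,
        mul_div_cancel_right₀ _ (hpos u ⟨hu.1, hu.2.le.trans hs⟩).ne']
    refine monotoneOn_of_deriv_nonneg (convex_Icc _ _) (hzc.mono (Icc_subset_Icc_right hs))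
      (fun t ht => ?_) fun t ht => ?_ <;> rw [interior_Icc] at ht
    · exact (hzder t ht).differentiableAt.differentiableWithinAt
    · rw [(hzder t ht).deriv]
      exact div_nonneg (div_nonneg (hWnn t ht) ht.1.le) (sq_nonneg _)
  have hρ : 0 ≤ ρ := hr.1.le.trans hr.2
  have hall : ∀ t ∈ Icc 0 ρ, 1 < z t := by
    by_contra! hcon
    obtain ⟨t, ht, htz⟩ := hcon
    have hcomp : IsCompact (Icc 0 ρ ∩ z ⁻¹' Iic 1) := isCompact_Icc.of_isClosed_subset
      (hzc.preimage_isClosed_of_isClosed isClosed_Icc isClosed_Iic) inter_subset_left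
    obtain ⟨s, ⟨hs, hsz⟩, hmin⟩ := hcomp.exists_isLeast ⟨t, ht, htz⟩
    have h1 := hmono s hs.2 (fun u hu => lt_of_not_ge fun hge =>
      hu.2.not_ge (hmin ⟨⟨hu.1, hu.2.le.trans hs.2⟩, hge⟩)) ⟨le_rfl, hs.1⟩ ⟨hs.1, le_rfl⟩ hs.1
    have h2 : z s ≤ 1 := hsz
    linarith
  have h1 := hmono ρ le_rfl (fun t ht => hall t (Ico_subset_Icc_self ht)) ⟨le_rfl, hρ⟩
    ⟨hr.1.le, hr.2⟩ hr.1.le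
  rw [hz0] at h1
  rw [hmul r ⟨hr.1.le, hr.2⟩]
  exact mul_le_mul_of_nonneg_right h1 (hpos r hr).le

/-! ### The shooting alternative -/

/-- The solution exceeds `1` while still positive. -/
def Escapes (d a : ℝ) : Prop :=
  ∃ r > 0, (∀ t ∈ Ioc 0 r, 0 < solution d a t) ∧ 1 < solution d a r

/-- The solution becomes negative before reaching `1`. -/
def Dips (d a : ℝ) : Prop :=
  ∃ r > 0, solution d a r < 0 ∧ ∀ t ∈ Ioc 0 r, solution d a t < 1

/-- The solution has values in `]0, 1]`. -/
def Stays (d a : ℝ) : Prop := ∀ r, 0 < r → 0 < solution d a r ∧ solution d a r ≤ 1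

lemma Escapes.not_dips {d a : ℝ} (h : Escapes d a) : ¬ Dips d a := by
  rintro ⟨s, hs, hsn, hs1⟩
  obtain ⟨r, hr, hpos, hr1⟩ := h
  rcases le_total r s with hrs | hrs
  · exact hr1.not_gt (hs1 r ⟨hr, hrs⟩)
  · exact hsn.not_gt (hpos s ⟨hs, hrs⟩)

lemma Stays.not_escapes {d a : ℝ} (h : Stays d a) : ¬ Escapes d a := by
  rintro ⟨r, hr, -, hr1⟩
  exact hr1.not_ge (h r hr).2

lemma Stays.not_dips {d a : ℝ} (h : Stays d a) : ¬ Dips d a := by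
  rintro ⟨r, hr, hrn, -⟩
  exact hrn.not_gt (h r hr).1

lemma Escapes.mono {d a b : ℝ} (hd : 0 < d) (ha : 0 < a) (hab : a ≤ b) (h : Escapes d a) :
    Escapes d b := by
  rcases eq_or_lt_of_le hab with rfl | hab
  · exact h
  obtain ⟨r, hr, hpos, hr1⟩ := h
  have hba : 1 < b / a := (one_lt_div ha).2 hab
  have hle : ∀ t ∈ Ioc 0 r, solution d a t ≤ solution d b t := fun t ht =>
    (le_mul_of_one_le_left (hpos t ht).le hba.le).trans (mul_solution_le hd ha hab hpos ht)
  exact ⟨r, hr, fun t ht => (hpos t ht).trans_le (hle t ht), hr1.trans_le (hle r ⟨hr, le_rfl⟩)⟩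

lemma continuous_profile_joint :
    Continuous fun x : (Ioi (0 : ℝ) × ℝ) × ℝ => profile x.1.1 x.1.2 |x.2| := by
  rw [continuous_iff_continuousAt]
  rintro ⟨⟨d₀, a₀⟩, r₀⟩
  rw [ContinuousAt, Metric.tendsto_nhds]
  intro e he
  have h1 : ∀ᶠ x : (Ioi (0 : ℝ) × ℝ) × ℝ in 𝓝 ((d₀, a₀), r₀), ∀ r ∈ Icc 0 (|r₀| + 1),
      |profile x.1.1 x.1.2 r - profile d₀ a₀ r| ≤ e / 2 :=
    (continuous_fst.tendsto ((d₀, a₀), r₀)).eventually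
      (eventually_profile_near d₀ a₀ (|r₀| + 1) (half_pos he))
  have hc : Continuous fun x : (Ioi (0 : ℝ) × ℝ) × ℝ => profile d₀ a₀ |x.2| :=
    (continuous_profile d₀.2 a₀).comp continuous_snd.abs
  have h2 := (Metric.tendsto_nhds.1 (hc.tendsto ((d₀, a₀), r₀))) (e / 2) (half_pos he)
  have h3 : ∀ᶠ x : (Ioi (0 : ℝ) × ℝ) × ℝ in 𝓝 ((d₀, a₀), r₀), |x.2| < |r₀| + 1 :=
    (continuous_snd.abs.tendsto ((d₀, a₀), r₀)).eventually (gt_mem_nhds (by simp))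
  filter_upwards [h1, h2, h3] with x hx1 hx2 hx3
  have h4 := hx1 |x.2| ⟨abs_nonneg _, hx3.le⟩
  calc _ ≤ dist (profile x.1.1 x.1.2 |x.2|) (profile d₀ a₀ |x.2|)
        + dist (profile d₀ a₀ |x.2|) (profile d₀ a₀ |r₀|) := dist_triangle _ _ _
    _ < e / 2 + e / 2 := add_lt_add_of_le_of_lt (by rw [Real.dist_eq]; exact h4) hx2
    _ = e := add_halves e

lemma continuous_solution_joint :
    Continuous fun x : (Ioi (0 : ℝ) × ℝ) × ℝ => solution x.1.1 x.1.2 |x.2| := by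
  refine Continuous.mul ?_ continuous_profile_joint
  exact continuous_snd.abs.rpow (by fun_prop) fun x => Or.inr x.1.1.2

lemma eventually_escapes {d₀ : Ioi (0 : ℝ)} {a₀ : ℝ} (ha : 0 < a₀) (h : Escapes d₀ a₀) :
    ∀ᶠ p : Ioi (0 : ℝ) × ℝ in 𝓝 (d₀, a₀), Escapes p.1 p.2 := by
  obtain ⟨r, hr, hpos, hr1⟩ := h
  have hg := profile_pos d₀.2 ha hpos
  have h1 : ∀ᶠ p : Ioi (0 : ℝ) × ℝ in 𝓝 (d₀, a₀), ∀ t ∈ Icc 0 r, 0 < profile p.1 p.2 |t| :=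
    isCompact_Icc.eventually_forall_of_forall_eventually fun t ht =>
      (continuous_profile_joint.tendsto ((d₀, a₀), t)).eventually (lt_mem_nhds (by
        simp only [abs_of_nonneg ht.1]; exact hg t ht))
  have hc : Continuous fun p : Ioi (0 : ℝ) × ℝ => solution p.1 p.2 |r| :=
    continuous_solution_joint.comp (by fun_prop : Continuous fun p : Ioi (0 : ℝ) × ℝ => (p, r))
  have h2 : ∀ᶠ p : Ioi (0 : ℝ) × ℝ in 𝓝 (d₀, a₀), 1 < solution p.1 p.2 |r| :=
    (hc.tendsto (d₀, a₀)).eventually (lt_mem_nhds (by rwa [abs_of_pos hr]))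
  filter_upwards [h1, h2] with p hp1 hp2
  rw [abs_of_pos hr] at hp2
  refine ⟨r, hr, fun t ht => (solution_pos_iff ht.1).2 ?_, hp2⟩
  have := hp1 t ⟨ht.1.le, ht.2⟩
  rwa [abs_of_pos ht.1] at this

lemma eventually_dips {d₀ : Ioi (0 : ℝ)} {a₀ : ℝ} (h : Dips d₀ a₀) :
    ∀ᶠ p : Ioi (0 : ℝ) × ℝ in 𝓝 (d₀, a₀), Dips p.1 p.2 := by
  obtain ⟨r, hr, hrn, hlt⟩ := h
  have h1 : ∀ᶠ p : Ioi (0 : ℝ) × ℝ in 𝓝 (d₀, a₀), ∀ t ∈ Icc 0 r, solution p.1 p.2 |t| < 1 :=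
    isCompact_Icc.eventually_forall_of_forall_eventually fun t ht =>
      (continuous_solution_joint.tendsto ((d₀, a₀), t)).eventually (gt_mem_nhds (by
        simp only [abs_of_nonneg ht.1]
        rcases eq_or_lt_of_le ht.1 with rfl | h0
        · rw [solution_zero d₀.2]; exact one_pos
        · exact hlt t ⟨h0, ht.2⟩))
  have hc : Continuous fun p : Ioi (0 : ℝ) × ℝ => solution p.1 p.2 |r| :=
    continuous_solution_joint.comp (by fun_prop : Continuous fun p : Ioi (0 : ℝ) × ℝ => (p, r))
  have h2 : ∀ᶠ p : Ioi (0 : ℝ) × ℝ in 𝓝 (d₀, a₀), solution p.1 p.2 |r| < 0 :=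
    (hc.tendsto (d₀, a₀)).eventually (gt_mem_nhds (by rwa [abs_of_pos hr]))
  filter_upwards [h1, h2] with p hp1 hp2
  rw [abs_of_pos hr] at hp2
  refine ⟨r, hr, hp2, fun t ht => ?_⟩
  have := hp1 t ⟨ht.1.le, ht.2⟩
  rwa [abs_of_pos ht.1] at this

/-- Second derivative test for `w'' + w'/r > 0`, with `y = r w'`. -/
lemma not_isLocalMax_of_hasDerivAt {w y : ℝ → ℝ} {x D : ℝ} (hx : 0 < x)
    (hw : ∀ᶠ r in 𝓝 x, HasDerivAt w (y r / r) r) (hy : HasDerivAt y D x) (hD : 0 < D) :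
    ¬ IsLocalMax w x := by
  intro hmax
  have hy0 : y x = 0 := by
    rcases div_eq_zero_iff.1 (hmax.hasDerivAt_eq_zero hw.self_of_nhds) with h | h
    · exact h
    · exact absurd h hx.ne'
  have hslope := (hasDerivAt_iff_tendsto_slope.1 hy).eventually (lt_mem_nhds hD)
  have hright : ∀ᶠ u in 𝓝[>] x, 0 < slope y x u :=
    hslope.filter_mono (nhdsWithin_mono _ fun u hu => ne_of_gt hu)
  obtain ⟨s, hs, hsub⟩ := mem_nhdsGT_iff_exists_Ioc_subset.1 (hright.and
    ((hw.and hmax).filter_mono (nhdsWithin_le_nhds (s := Ioi x))))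
  have hs : x < s := hs
  have hcont : ContinuousOn w (Icc x s) := by
    intro u hu
    rcases eq_or_lt_of_le hu.1 with rfl | h
    · exact hw.self_of_nhds.continuousAt.continuousWithinAt
    · exact (hsub ⟨h, hu.2⟩).2.1.continuousAt.continuousWithinAt
  obtain ⟨ξ, hξ, hξe⟩ := exists_hasDerivAt_eq_slope w _ hs hcont
    fun u hu => (hsub (Ioo_subset_Ioc_self hu)).2.1
  have h1 := (hsub (Ioo_subset_Ioc_self hξ)).1
  rw [slope_def_field, hy0, sub_zero] at h1
  have h2 : 0 < y ξ := (div_pos_iff_of_pos_right (by linarith [hξ.1])).1 h1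
  have h3 : 0 < (w s - w x) / (s - x) := hξe ▸ div_pos h2 (hx.trans hξ.1)
  have h4 := (div_pos_iff_of_pos_right (by linarith)).1 h3
  linarith [(hsub ⟨hs, le_rfl⟩).2.2]

/-- A solution that is at most `1` cannot touch `1`, since there `f'' + f'/r = d²/r² > 0`. -/
lemma solution_lt_one {d a ρ : ℝ} (hd : 0 < d) (hle : ∀ t ∈ Ioo 0 ρ, solution d a t ≤ 1) :
    ∀ t ∈ Ioo 0 ρ, solution d a t < 1 := by
  intro t ht
  refine lt_of_le_of_ne (hle t ht) fun he => ?_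
  have hder := hasDerivAt_momentum hd a ht.1
  rw [he, cutoff_of_one_le (by simp)] at hder
  simp only [mul_one, mul_zero, sub_zero] at hder
  refine not_isLocalMax_of_hasDerivAt (w := solution d a) ht.1 ?_ hder (div_pos (pow_pos hd 2) ht.1) ?_
  · filter_upwards [lt_mem_nhds ht.1] with u hu using hasDerivAt_solution hd a hu
  · filter_upwards [Ioo_mem_nhds ht.1 ht.2] with u hu
    rw [he]; exact hle u hu

/-- At its first zero a solution that has not escaped has negative slope, so it dips. -/
theorem escapes_or_dips_or_stays {d a : ℝ} (hd : 0 < d) (ha : 0 < a) :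
    Escapes d a ∨ Dips d a ∨ Stays d a := by
  by_cases hE : Escapes d a
  · exact Or.inl hE
  refine Or.inr ?_
  have hnE : ∀ r, 0 < r → (∀ t ∈ Ioc 0 r, 0 < solution d a t) → solution d a r ≤ 1 :=
    fun r hr h => not_lt.1 fun hlt => hE ⟨r, hr, h, hlt⟩
  by_cases hall : ∀ t, 0 < t → 0 < solution d a t
  · exact Or.inr fun r hr => ⟨hall r hr, hnE r hr fun t ht => hall t ht.1⟩
  left
  push Not at hall
  obtain ⟨r, hr, hrn⟩ := hall
  obtain ⟨δ, hδ, hδpos⟩ := exists_pos_near_zero hd ha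
  have hcF := continuous_solution hd a
  -- `r₀` is the first zero
  have hcomp : IsCompact (Icc δ r ∩ solution d a ⁻¹' Iic 0) :=
    isCompact_Icc.inter_right (isClosed_Iic.preimage hcF)
  have hδr : δ < r := lt_of_not_ge fun hle => (hδpos r ⟨hr, hle⟩).1.not_ge hrn
  obtain ⟨r₀, ⟨hr₀, hr₀n⟩, hmin⟩ := hcomp.exists_isLeast ⟨r, ⟨hδr.le, le_rfl⟩, hrn⟩
  have hr₀n' : solution d a r₀ ≤ 0 := hr₀n
  have hδr₀ : δ < r₀ := lt_of_le_of_ne hr₀.1 fun he => by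
    rw [← he] at hr₀n'; exact hr₀n'.not_gt (hδpos δ ⟨hδ, le_rfl⟩).1
  have hr₀0 : 0 < r₀ := hδ.trans hδr₀
  have hpos : ∀ t ∈ Ioo 0 r₀, 0 < solution d a t := by
    intro t ht
    rcases le_total t δ with h | h
    · exact (hδpos t ⟨ht.1, h⟩).1
    · exact lt_of_not_ge fun hge => ht.2.not_ge (hmin ⟨⟨h, ht.2.le.trans hr₀.2⟩, hge⟩)
  have hlt := solution_lt_one hd fun t ht =>
    hnE t ht.1 fun u hu => hpos u ⟨hu.1, hu.2.trans_lt ht.2⟩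
  obtain ⟨ξ, hξ, hξe⟩ := exists_hasDerivAt_eq_slope (solution d a) _ hδr₀ hcF.continuousOn
    (fun t ht => hasDerivAt_solution hd a (hδ.trans ht.1))
  have hξ0 : 0 < ξ := hδ.trans hξ.1
  have hPξ : momentum d a ξ < 0 := by
    have : (solution d a r₀ - solution d a δ) / (r₀ - δ) < 0 :=
      div_neg_of_neg_of_pos (by linarith [(hδpos δ ⟨hδ, le_rfl⟩).1]) (by linarith)
    rw [← hξe] at this
    exact (div_neg_iff.1 this).elim (fun h => by linarith [h.2]) fun h => h.1
  have hPr₀ : momentum d a r₀ < 0 := by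
    have hle := momentum_le_of_neg hd ha hpos ⟨hξ0, hξ.2⟩ hPξ
    have hc : Tendsto (momentum d a) (𝓝[<] r₀) (𝓝 (momentum d a r₀)) :=
      (hasDerivAt_momentum hd a hr₀0).continuousAt.tendsto.mono_left nhdsWithin_le_nhds
    refine lt_of_le_of_lt (le_of_tendsto hc ?_) hPξ
    filter_upwards [Ioo_mem_nhdsLT hξ.2] with u hu using hle u ⟨hu.1.le, hu.2⟩
  obtain ⟨s, hs, hsP⟩ := mem_nhdsGE_iff_exists_Icc_subset.1
    (((hasDerivAt_momentum hd a hr₀0).continuousAt.tendsto.eventually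
      (gt_mem_nhds hPr₀)).filter_mono (nhdsWithin_le_nhds (s := Ici r₀)))
  have hs : r₀ < s := hs
  have hanti : ∀ t ∈ Ioc r₀ s, solution d a t < solution d a r₀ := by
    intro t ht
    obtain ⟨η, hη, hηe⟩ := exists_hasDerivAt_eq_slope (solution d a) _ ht.1 hcF.continuousOn
      (fun t ht => hasDerivAt_solution hd a (hr₀0.trans ht.1))
    have h1 : momentum d a η < 0 := hsP ⟨hη.1.le, hη.2.le.trans ht.2⟩
    have h2 : momentum d a η / η < 0 := div_neg_of_neg_of_pos h1 (hr₀0.trans hη.1)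
    rw [hηe] at h2
    rcases div_neg_iff.1 h2 with h | h
    · linarith [h.2, ht.1]
    · linarith [h.1]
  refine ⟨s, hr₀0.trans hs, (hanti s ⟨hs, le_rfl⟩).trans_le hr₀n', fun t ht => ?_⟩
  rcases lt_or_ge t r₀ with h | h
  · exact hlt t ⟨ht.1, h⟩
  · rcases eq_or_lt_of_le h with rfl | h
    · linarith
    · linarith [hanti t ⟨h, ht.2⟩]

/-- For small `a` the solution stays in the linear regime long enough to oscillate. -/
lemma exists_forall_not_escapes {d : ℝ} (hd : 0 < d) :
    ∃ a₀ > 0, ∀ a, 0 < a → a ≤ a₀ → ¬ Escapes d a := by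
  set T : ℝ := 2 * d * Real.exp (1 / d) with hT
  have hT0 : 0 < T := by positivity
  have hTd : 0 < T ^ d := Real.rpow_pos_of_pos hT0 d
  refine ⟨1 / (2 * T ^ d), by positivity, ?_⟩
  rintro a ha haT ⟨r, hr, hpos, hr1⟩
  have haT' : a * T ^ d ≤ 1 / 2 := by
    rw [le_div_iff₀ (by positivity)] at haT; linarith
  have hg := profile_pos hd ha hpos
  have hFle : ∀ t ∈ Ioc 0 r, t ≤ T → solution d a t ≤ 1 / 2 := by
    intro t ht htT
    have h1 := profile_le hd ht.1.le fun u hu => (hg u ⟨hu.1, hu.2.trans ht.2⟩).le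
    have h2 : t ^ d ≤ T ^ d := Real.rpow_le_rpow ht.1.le htT hd.le
    calc solution d a t = t ^ d * profile d a t := rfl
      _ ≤ T ^ d * a := mul_le_mul h2 h1 (hg t ⟨ht.1.le, ht.2⟩).le hTd.le
      _ ≤ 1 / 2 := by linarith
  have hTr : T < r := lt_of_not_ge fun hle => by linarith [hFle r ⟨hr, le_rfl⟩ hle]
  have hP : ∀ t ∈ Ioc 0 T, 0 ≤ momentum d a t := by
    intro t ht
    by_contra! hneg
    have htr : t < r := ht.2.trans_lt hTr
    have h1 := momentum_le_of_neg hd ha (fun u hu => hpos u (Ioo_subset_Ioc_self hu))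
      ⟨ht.1, htr⟩ hneg
    have h2 := antitoneOn_solution (s := r) hd ht.1
      (fun u hu => (h1 u ⟨hu.1.le, hu.2⟩).trans hneg.le) ⟨le_rfl, htr.le⟩ ⟨htr.le, le_rfl⟩ htr.le
    linarith [hFle t ⟨ht.1, htr.le⟩ ht.2]
  have h2d : 0 < 2 * d := by linarith
  have h2dT : 2 * d ≤ T := le_mul_of_one_le_right h2d.le (Real.one_le_exp (by positivity))
  have hmono := monotoneOn_solution (s := T) hd h2d fun t ht => hP t ⟨h2d.trans ht.1, ht.2.le⟩
  have hF2d := hpos (2 * d) ⟨h2d, h2dT.trans hTr.le⟩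
  have h := le_sub_mul_log (c := 2 * d ^ 2 * solution d a (2 * d)) h2d h2dT
    (fun t ht => hasDerivAt_momentum hd a (h2d.trans_le ht.1)) (fun t ht => by
      have ht0 : 0 < t := h2d.trans_le ht.1
      have htr : t ∈ Ioc 0 r := ⟨ht0, ht.2.trans hTr.le⟩
      have h1 := hpos t htr
      have h2 := hFle t htr ht.2
      have h3 : solution d a (2 * d) ≤ solution d a t := hmono ⟨le_rfl, h2dT⟩ ht ht.1
      rw [cutoff_of_le h1.le (by linarith)]
      have e : d ^ 2 * solution d a t / t - t * (solution d a t * (1 - solution d a t ^ 2))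
        = -((solution d a t * (t ^ 2 * (1 - solution d a t ^ 2) - d ^ 2)) / t) := by
          field_simp; ring
      rw [e]
      refine neg_le_neg (div_le_div_of_nonneg_right ?_ ht0.le)
      have h4 : 2 * d ^ 2 ≤ t ^ 2 * (1 - solution d a t ^ 2) - d ^ 2 := by
        have h5 : (2 * d) ^ 2 ≤ t ^ 2 := pow_le_pow_left₀ h2d.le ht.1 2
        have h6 : 3 / 4 ≤ 1 - solution d a t ^ 2 := by nlinarith
        nlinarith [sq_nonneg t]
      calc 2 * d ^ 2 * solution d a (2 * d) ≤ 2 * d ^ 2 * solution d a t :=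
            mul_le_mul_of_nonneg_left h3 (by positivity)
        _ ≤ _ := by rw [mul_comm]; exact mul_le_mul_of_nonneg_left h4 h1.le)
  have e : T / (2 * d) = Real.exp (1 / d) := by rw [hT]; field_simp
  rw [e, Real.log_exp] at h
  have e2 : 2 * d ^ 2 * solution d a (2 * d) * (1 / d) = 2 * (d * solution d a (2 * d)) := by
    field_simp
  rw [e2] at h
  have h1 := momentum_le (a := a) hd h2d fun t ht =>
    (hg t ⟨ht.1, ht.2.trans (h2dT.trans hTr.le)⟩).le
  have h2 := hP T ⟨hT0, le_rfl⟩
  have h3 := mul_pos hd hF2d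
  linarith

/-- For large `a`, the solution is close to `a r^d` on `]0, √d]` and escapes there. -/
lemma exists_escapes {d : ℝ} (hd : 0 < d) : ∃ a > 0, Escapes d a := by
  set ρ := √d with hρ
  have hρ0 : 0 < ρ := Real.sqrt_pos.2 hd
  have hρ2 : ρ ^ 2 = d := Real.sq_sqrt hd.le
  have hρd : 0 < ρ ^ d := Real.rpow_pos_of_pos hρ0 d
  set a := 2 * (ρ ^ d)⁻¹ with ha
  have ha0 : 0 < a := by positivity
  obtain ⟨x, hx, hmax⟩ := isCompact_Icc.exists_isMaxOn (nonempty_Icc.2 hρ0.le)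
    (continuous_profile hd a).abs.continuousOn
  set M := |profile d a x| with hM
  have hM' : ∀ t ∈ Icc 0 ρ, |profile d a t| ≤ M := fun t ht => hmax ht
  have hpot : ∀ t ∈ Icc 0 ρ, |potential d (source d (profile d a)) t| ≤ M / 4 := by
    intro t ht
    refine (abs_potential_le_const hd ht.1 fun u hu => (abs_source_le _ _ _).trans
      (hM' u ⟨hu.1, hu.2.trans ht.2⟩)).trans ?_
    rw [div_le_div_iff₀ (by positivity) (by positivity)]
    have : t ^ 2 ≤ d := by rw [← hρ2]; exact pow_le_pow_left₀ ht.1 ht.2 2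
    have := mul_le_mul_of_nonneg_left this (abs_nonneg (profile d a x))
    linarith
  have hMle : M ≤ a + M / 4 := by
    have h1 := hpot x hx
    have h2 : M = |a - potential d (source d (profile d a)) x| := by rw [hM, profile_eq hd a x]
    have h3 := abs_sub a (potential d (source d (profile d a)) x)
    rw [abs_of_pos ha0] at h3
    linarith
  have hge : ∀ t ∈ Icc 0 ρ, 2 / 3 * a ≤ profile d a t := by
    intro t ht
    rw [profile_eq hd a t]
    linarith [le_abs_self (potential d (source d (profile d a)) t), hpot t ht]
  refine ⟨a, ha0, ρ, hρ0, fun t ht => (solution_pos_iff ht.1).2 ?_, ?_⟩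
  · exact lt_of_lt_of_le (by positivity) (hge t ⟨ht.1.le, ht.2⟩)
  · have h1 := mul_le_mul_of_nonneg_left (hge ρ ⟨hρ0.le, le_rfl⟩) hρd.le
    have h2 : ρ ^ d * (2 / 3 * a) = 4 / 3 := by rw [ha]; field_simp; norm_num
    rw [h2] at h1
    exact lt_of_lt_of_le (by norm_num) h1

/-- The infimum of the escaping coefficients neither escapes nor dips, as these two conditions
are open. -/
theorem exists_stays {d : ℝ} (hd : 0 < d) : ∃ A > 0, Stays d A := by
  set S : Set ℝ := {a | 0 < a ∧ Escapes d a} with hS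
  obtain ⟨b, hb, hbE⟩ := exists_escapes hd
  obtain ⟨a₀, ha₀, hsmall⟩ := exists_forall_not_escapes hd
  have hlb : a₀ ∈ lowerBounds S := fun a ha => (lt_of_not_ge fun hle => hsmall a ha.1 hle ha.2).le
  have hne : S.Nonempty := ⟨b, hb, hbE⟩
  have hA : IsGLB S (sInf S) := isGLB_csInf hne ⟨a₀, hlb⟩
  set A := sInf S
  have hA0 : 0 < A := ha₀.trans_le (hA.2 hlb)
  have hc : Tendsto (fun a : ℝ => ((⟨d, hd⟩ : Ioi (0 : ℝ)), a)) (𝓝 A) (𝓝 (⟨d, hd⟩, A)) :=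
    (by fun_prop : Continuous fun a : ℝ => ((⟨d, hd⟩ : Ioi (0 : ℝ)), a)).tendsto A
  refine ⟨A, hA0, ?_⟩
  rcases escapes_or_dips_or_stays hd hA0 with h | h | h
  · exfalso
    have h1 := hc.eventually (eventually_escapes (d₀ := ⟨d, hd⟩) hA0 h)
    obtain ⟨a, ⟨haE, ha0⟩, haA⟩ := (((h1.and (lt_mem_nhds hA0)).filter_mono
      (nhdsWithin_le_nhds (s := Iio A))).and self_mem_nhdsWithin).exists
    exact (hA.1 ⟨ha0, haE⟩).not_gt haA
  · exfalso
    have h1 := hc.eventually (eventually_dips (d₀ := ⟨d, hd⟩) h)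
    obtain ⟨a, haD, haA⟩ := ((h1.filter_mono
      (nhdsWithin_le_nhds (s := Ioi A))).and self_mem_nhdsWithin).exists
    obtain ⟨a', ha', -, haa'⟩ := hA.exists_between haA
    exact (ha'.2.mono hd ha'.1 haa'.le).not_dips haD
  · exact h

lemma Stays.momentum_nonneg {d a r : ℝ} (hd : 0 < d) (ha : 0 < a) (h : Stays d a) (hr : 0 < r) :
    0 ≤ momentum d a r := momentum_nonneg_of_pos hd ha (fun t ht => (h t ht).1) hr

lemma Stays.monotoneOn {d a : ℝ} (hd : 0 < d) (ha : 0 < a) (h : Stays d a) :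
    MonotoneOn (solution d a) (Ioi 0) := by
  intro r hr s hs hrs
  exact monotoneOn_solution hd hr (fun t ht => h.momentum_nonneg hd ha (lt_trans hr ht.1))
    ⟨le_rfl, hrs⟩ ⟨hrs, le_rfl⟩ hrs

/-- If `f` stayed below some `m < 1`, then `r (r f')' ≤ - c < 0` for large `r`, and `r f'` would
become negative. -/
lemma Stays.tendsto {d a : ℝ} (hd : 0 < d) (ha : 0 < a) (h : Stays d a) :
    Tendsto (solution d a) atTop (𝓝 1) := by
  have hex : ∀ m < 1, ∃ r > 0, m < solution d a r := by
    by_contra! hcon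
    obtain ⟨m, hm, hle⟩ := hcon
    have hm0 : 0 < m := (h 1 one_pos).1.trans_le (hle 1 one_pos)
    have hη : 0 < 1 - m ^ 2 := by nlinarith
    -- beyond `R`, `r² (1 - f²) ≥ d² + 1`, and the momentum decreases at least logarithmically
    set R := √((d ^ 2 + 1) / (1 - m ^ 2)) with hR
    have hR0 : 0 < R := Real.sqrt_pos.2 (by positivity)
    have hR2 : R ^ 2 * (1 - m ^ 2) = d ^ 2 + 1 := by
      rw [hR, Real.sq_sqrt (by positivity)]; field_simp
    have hFR := (h R hR0).1
    set c := solution d a R with hc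
    have hPR := h.momentum_nonneg hd ha hR0
    set s := R * Real.exp ((momentum d a R + 1) / c) with hs
    have hRs : R ≤ s := le_mul_of_one_le_right hR0.le (Real.one_le_exp (by positivity))
    have key := le_sub_mul_log (c := c) hR0 hRs
      (fun t ht => hasDerivAt_momentum hd a (hR0.trans_le ht.1)) (fun t ht => by
        have ht0 : 0 < t := hR0.trans_le ht.1
        have h1 := h t ht0
        have h2 := hle t ht0
        have h3 : c ≤ solution d a t := h.monotoneOn hd ha hR0 ht0 ht.1
        rw [cutoff_of_le h1.1.le h1.2]
        have e : d ^ 2 * solution d a t / t - t * (solution d a t * (1 - solution d a t ^ 2))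
          = -((solution d a t * (t ^ 2 * (1 - solution d a t ^ 2) - d ^ 2)) / t) := by
            field_simp; ring
        rw [e]
        refine neg_le_neg (div_le_div_of_nonneg_right ?_ ht0.le)
        have h4 : 1 ≤ t ^ 2 * (1 - solution d a t ^ 2) - d ^ 2 := by
          have h5 : R ^ 2 ≤ t ^ 2 := pow_le_pow_left₀ hR0.le ht.1 2
          have h6 : 1 - m ^ 2 ≤ 1 - solution d a t ^ 2 := by
            linarith [pow_le_pow_left₀ h1.1.le h2 2]
          have := mul_le_mul h5 h6 hη.le (sq_nonneg t)
          linarith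
        exact h3.trans (le_mul_of_one_le_right h1.1.le h4))
    have e : s / R = Real.exp ((momentum d a R + 1) / c) := by rw [hs]; field_simp
    rw [e, Real.log_exp, mul_div_cancel₀ _ hFR.ne'] at key
    linarith [h.momentum_nonneg hd ha (hR0.trans_le hRs)]
  rw [tendsto_order]
  constructor
  · intro m hm
    obtain ⟨r, hr, hlt⟩ := hex m hm
    filter_upwards [eventually_ge_atTop r] with s hs
    exact hlt.trans_le (h.monotoneOn hd ha hr (hr.trans_le hs) hs)
  · intro m hm
    filter_upwards [eventually_gt_atTop 0] with s hs using (h s hs).2.trans_lt hm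

/-- By comparison, `a < b` would give `f_b ≥ (b/a) f_a → b/a > 1`. -/
lemma Stays.le {d a b : ℝ} (hd : 0 < d) (ha : 0 < a) (h : Stays d a) (h' : Stays d b) :
    b ≤ a := by
  by_contra! hab
  have hba : a / b < 1 := (div_lt_one (ha.trans hab)).2 hab
  obtain ⟨r, hr1, hr0⟩ := (((h.tendsto hd ha).eventually (lt_mem_nhds hba)).and
    (eventually_gt_atTop 0)).exists
  have h1 := mul_solution_le (ρ := r) hd ha hab (fun t ht => (h t ht.1).1) ⟨hr0, le_rfl⟩
  have h2 : b / a * (a / b) = 1 := by field_simp [(ha.trans hab).ne', ha.ne']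
  have h3 := mul_lt_mul_of_pos_left hr1 (div_pos (ha.trans hab) ha)
  linarith [(h' r hr0).2]

theorem Stays.unique {d a b : ℝ} (hd : 0 < d) (ha : 0 < a) (hb : 0 < b) (h : Stays d a)
    (h' : Stays d b) : a = b := le_antisymm (h'.le hd hb h) (h.le hd ha h')

/-- The coefficient of the monotone solution depends continuously on `d`. -/
theorem continuous_of_stays {A : Ioi (0 : ℝ) → ℝ} (hA0 : ∀ d, 0 < A d)
    (hA : ∀ d : Ioi (0 : ℝ), Stays d (A d)) : Continuous A := by
  rw [continuous_iff_continuousAt]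
  intro d₀
  have hc : ∀ a : ℝ, Tendsto (fun d : Ioi (0 : ℝ) => (d, a)) (𝓝 d₀) (𝓝 (d₀, a)) := fun a =>
    (by fun_prop : Continuous fun d : Ioi (0 : ℝ) => (d, a)).tendsto d₀
  rw [ContinuousAt, tendsto_order]
  constructor
  · intro m hm
    obtain ⟨a, ha, haA⟩ := exists_between (max_lt hm (hA0 d₀))
    have ha0 : 0 < a := (le_max_right m 0).trans_lt ha
    have hD : Dips d₀ a := by
      rcases escapes_or_dips_or_stays d₀.2 ha0 with h | h | h
      · exact absurd (h.mono d₀.2 ha0 haA.le) (hA d₀).not_escapes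
      · exact h
      · exact absurd (h.unique d₀.2 ha0 (hA0 d₀) (hA d₀)) haA.ne
    filter_upwards [(hc a).eventually (eventually_dips hD)] with d hd
    refine lt_of_not_ge fun hle => ?_
    -- for `a > A d` the solution cannot dip, by comparison with the one at `A d`
    have haA' : A d < a := hle.trans_lt ((le_max_left m 0).trans_lt ha)
    rcases escapes_or_dips_or_stays d.2 ha0 with h | h | h
    · exact h.not_dips hd
    · obtain ⟨r, hr, hrn, -⟩ := h
      have h1 := mul_solution_le (ρ := r) d.2 (hA0 d) haA' (fun t ht => (hA d t ht.1).1)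
        ⟨hr, le_rfl⟩
      have h2 := mul_pos (div_pos ha0 (hA0 d)) (hA d r hr).1
      linarith
    · exact h.not_dips hd
  · intro m hm
    obtain ⟨a, haA, ham⟩ := exists_between hm
    have ha0 : 0 < a := (hA0 d₀).trans haA
    have hE : Escapes d₀ a := by
      rcases escapes_or_dips_or_stays d₀.2 ha0 with h | h | h
      · exact h
      · obtain ⟨r, hr, hrn, -⟩ := h
        have h1 := mul_solution_le (ρ := r) d₀.2 (hA0 d₀) haA (fun t ht => (hA d₀ t ht.1).1)
          ⟨hr, le_rfl⟩
        have h2 := mul_pos (div_pos ha0 (hA0 d₀)) (hA d₀ r hr).1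
        linarith
      · exact absurd (h.unique d₀.2 ha0 (hA0 d₀) (hA d₀)) haA.ne'
    filter_upwards [(hc a).eventually (eventually_escapes ha0 hE)] with d hd
    refine (lt_of_not_ge fun hle => ?_).trans ham
    exact (hA d).not_escapes (hd.mono d.2 ha0 hle)

/-! ### Global monotone solutions -/

/-- A global nondecreasing solution never exceeds `1`, as it would blow up in finite time: with
`p = r f'`, `p² - (c/2) f⁴` is nondecreasing for some `c > 0`, so eventually `r f' ≥ κ f²`. -/
lemma le_one_of_isRadialFlow {d r₀ : ℝ} {f p : ℝ → ℝ} (hr₀ : 0 < r₀)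
    (hflow : IsRadialFlow d (fun z => 1 - z ^ 2) (Ioi 0) f p) (hmono : MonotoneOn f (Ioi 0))
    (hp : ∀ r, 0 < r → 0 ≤ p r) : f r₀ ≤ 1 := by
  by_contra! hm
  set m := f r₀ with hmdef
  have hm0 : 0 < m := by linarith
  set c := r₀ ^ 2 * (1 - 1 / m ^ 2) with hc
  have hm2 : 1 < m ^ 2 := by nlinarith
  have hc0 : 0 < c := by
    have : 1 / m ^ 2 < 1 := (div_lt_one (by positivity)).2 hm2
    exact mul_pos (by positivity) (by linarith)
  have hpos : ∀ r, r₀ ≤ r → 0 < r := fun r hr => hr₀.trans_le hr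
  have hf : ∀ r, r₀ ≤ r → m ≤ f r := fun r hr => hmono hr₀ (hpos r hr) hr
  have hp' : ∀ r, r₀ ≤ r → c * f r ^ 3 / r ≤ d ^ 2 * f r / r - r * (f r * (1 - f r ^ 2)) := by
    intro r hr
    have h0 := hpos r hr
    have h1 := hf r hr
    have hfr : 0 < f r := hm0.trans_le h1
    have h2 : (1 - 1 / m ^ 2) * f r ^ 2 ≤ f r ^ 2 - 1 := by
      have : 1 ≤ 1 / m ^ 2 * f r ^ 2 := by
        rw [one_div, inv_mul_eq_div, one_le_div (by positivity)]
        exact pow_le_pow_left₀ hm0.le h1 2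
      linarith
    have h3 : c * f r ^ 2 ≤ r ^ 2 * (f r ^ 2 - 1) := by
      have h4 : r₀ ^ 2 ≤ r ^ 2 := pow_le_pow_left₀ hr₀.le hr 2
      have h5 : 0 ≤ f r ^ 2 - 1 := by nlinarith
      calc c * f r ^ 2 = r₀ ^ 2 * ((1 - 1 / m ^ 2) * f r ^ 2) := by rw [hc]; ring
        _ ≤ r₀ ^ 2 * (f r ^ 2 - 1) := mul_le_mul_of_nonneg_left h2 (sq_nonneg _)
        _ ≤ _ := mul_le_mul_of_nonneg_right h4 h5
    have e : d ^ 2 * f r / r - r * (f r * (1 - f r ^ 2))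
        = f r * (d ^ 2 + r ^ 2 * (f r ^ 2 - 1)) / r := by field_simp; ring
    rw [e]
    refine div_le_div_of_nonneg_right ?_ h0.le
    nlinarith [mul_le_mul_of_nonneg_left h3 hfr.le, mul_nonneg hfr.le (sq_nonneg d)]
  -- `p` grows at least like `log r`
  obtain ⟨r₁, hr₁, hp1⟩ : ∃ r₁, r₀ ≤ r₁ ∧ 1 ≤ p r₁ := by
    set s := r₀ * Real.exp (1 / (c * m ^ 3)) with hs
    have hrs : r₀ ≤ s := le_mul_of_one_le_right hr₀.le (Real.one_le_exp (by positivity))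
    have h := le_sub_mul_log (u := fun r => -p r) (c := c * m ^ 3) hr₀ hrs
      (fun t ht => (hflow t (hpos t ht.1)).2.neg) (fun t ht => by
        refine neg_le_neg (le_trans ?_ (hp' t ht.1))
        exact div_le_div_of_nonneg_right (mul_le_mul_of_nonneg_left
          (pow_le_pow_left₀ hm0.le (hf t ht.1) 3) hc0.le) (hpos t ht.1).le)
    have e : s / r₀ = Real.exp (1 / (c * m ^ 3)) := by rw [hs]; field_simp
    rw [e, Real.log_exp, mul_one_div_cancel (by positivity)] at h
    exact ⟨s, hrs, by linarith [hp r₀ hr₀]⟩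
  have hpmono : ∀ r, r₁ ≤ r → 1 ≤ p r := by
    intro r hr
    have hmon : MonotoneOn p (Ici r₀) := by
      refine monotoneOn_of_deriv_nonneg (convex_Ici _)
        (fun t ht => (hflow t (hpos t ht)).2.continuousAt.continuousWithinAt)
        (fun t ht => ?_) fun t ht => ?_ <;> rw [interior_Ici] at ht
      · exact (hflow t (hr₀.trans ht)).2.differentiableAt.differentiableWithinAt
      · have ht' : r₀ < t := ht
        rw [(hflow t (hr₀.trans ht)).2.deriv]
        refine le_trans ?_ (hp' t ht'.le)
        have := hm0.trans_le (hf t ht'.le)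
        have := hpos t ht'.le
        positivity
    exact hp1.trans (hmon hr₁ (hr₁.trans hr) hr)
  obtain ⟨r₂, hr₂, hf2⟩ : ∃ r₂, r₁ ≤ r₂ ∧ 2 * m ≤ f r₂ := by
    have hr₁0 := hpos r₁ hr₁
    set s := r₁ * Real.exp m with hs
    have hrs : r₁ ≤ s := le_mul_of_one_le_right hr₁0.le (Real.one_le_exp hm0.le)
    have h := le_sub_mul_log (u := fun r => -f r) (c := 1) hr₁0 hrs
      (fun t ht => (hflow t (hpos t (hr₁.trans ht.1))).1.neg) (fun t ht => by
        refine neg_le_neg ?_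
        exact div_le_div_of_nonneg_right (hpmono t ht.1) (hpos t (hr₁.trans ht.1)).le)
    have e : s / r₁ = Real.exp m := by rw [hs]; field_simp
    rw [e, Real.log_exp, one_mul] at h
    exact ⟨s, hrs, by linarith [hf r₁ hr₁]⟩
  have hr₀₂ : r₀ ≤ r₂ := hr₁.trans hr₂
  have hE : MonotoneOn (fun r => p r ^ 2 - c / 2 * f r ^ 4) (Ici r₀) := by
    have hder : ∀ t, 0 < t → HasDerivAt (fun r => p r ^ 2 - c / 2 * f r ^ 4)
        (2 * p t * ((d ^ 2 * f t / t - t * (f t * (1 - f t ^ 2))) - c * f t ^ 3 / t)) t := by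
      intro t ht
      convert! ((hflow t ht).2.pow 2).sub (((hflow t ht).1.pow 4).const_mul (c / 2)) using 1
      field_simp
      ring
    refine monotoneOn_of_deriv_nonneg (convex_Ici _)
      (fun t ht => (hder t (hpos t ht)).continuousAt.continuousWithinAt)
      (fun t ht => ?_) fun t ht => ?_ <;> rw [interior_Ici] at ht
    · exact (hder t (hr₀.trans ht)).differentiableAt.differentiableWithinAt
    · rw [(hder t (hr₀.trans ht)).deriv]
      have ht' : r₀ < t := ht
      exact mul_nonneg (by linarith [hp t (hr₀.trans ht)]) (by linarith [hp' t ht'.le])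
  -- beyond `r₂` the constant `m⁴` is absorbed
  set κ := √c / 2 with hκ
  have hκ0 : 0 < κ := by positivity
  have hκ2 : κ ^ 2 = c / 4 := by rw [hκ, div_pow, Real.sq_sqrt hc0.le]; norm_num
  have hpf : ∀ r, r₂ ≤ r → κ * f r ^ 2 ≤ p r := by
    intro r hr
    have hr0 := hr₀₂.trans hr
    refine le_of_pow_le_pow_left₀ two_ne_zero (hp r (hpos r hr0)) ?_
    have h1 := hE (self_mem_Ici : r₀ ∈ Ici r₀) hr0 hr0
    simp only at h1
    have h2 : 2 * m ≤ f r := hf2.trans (hmono (hpos r₂ hr₀₂) (hpos r hr0) hr)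
    have h3 : (2 * m) ^ 4 ≤ f r ^ 4 := pow_le_pow_left₀ (by positivity) h2 4
    have h4 : 0 < m ^ 4 := by positivity
    have h5 : m ^ 4 ≤ f r ^ 4 / 2 := by nlinarith
    have h6 := mul_le_mul_of_nonneg_left h5 hc0.le
    calc (κ * f r ^ 2) ^ 2 = c / 4 * f r ^ 4 := by rw [mul_pow, hκ2]; ring
      _ ≤ p r ^ 2 := by nlinarith [sq_nonneg (p r₀)]
  have hr₂0 := hpos r₂ hr₀₂
  have hff : ∀ t, r₂ ≤ t → 0 < f t := fun t ht => hm0.trans_le (hf t (hr₀₂.trans ht))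
  set s := r₂ * Real.exp (1 / (κ * f r₂)) with hs
  have hrs : r₂ ≤ s := le_mul_of_one_le_right hr₂0.le
    (Real.one_le_exp (by have := hff r₂ le_rfl; positivity))
  have h := le_sub_mul_log (u := fun r => (f r)⁻¹) (c := κ) hr₂0 hrs
    (fun t ht => (hflow t (hpos t (hr₀₂.trans ht.1))).1.inv (hff t ht.1).ne') (fun t ht => by
      have h0 := hpos t (hr₀₂.trans ht.1)
      have h1 := hff t ht.1
      rw [neg_div, neg_le_neg_iff, div_div (p t) t, div_le_div_iff₀ h0 (by positivity)]
      nlinarith [mul_le_mul_of_nonneg_left (hpf t ht.1) h0.le])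
  have e : s / r₂ = Real.exp (1 / (κ * f r₂)) := by rw [hs]; field_simp
  have e2 : κ * (1 / (κ * f r₂)) = (f r₂)⁻¹ := by
    have := (hff r₂ le_rfl).ne'
    field_simp
  rw [e, Real.log_exp, e2, sub_self] at h
  exact h.not_gt (inv_pos.2 (hff s hrs))

lemma IsGlobalMonotone.pos {d a : ℝ} (ha : 0 < a) {f : ℝ → ℝ} (h : IsGlobalMonotone d a f)
    {r : ℝ} (hr : 0 < r) : 0 < f r := by
  have h1 := h.1.2.eventually (lt_mem_nhds one_pos)
  obtain ⟨s, hs1, hs2⟩ := (h1.and (Ioo_mem_nhdsGT hr)).exists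
  have h2 : 0 < f s := by
    have h3 : 0 < 1 / a * f s := pos_of_mul_pos_left hs1 (Real.rpow_pos_of_pos hs2.1 _).le
    exact pos_of_mul_pos_right h3 (by positivity)
  exact h2.trans_le (h.2 hs2.1 hr hs2.2.le)

lemma IsGlobalMonotone.le_one {d a : ℝ} {f : ℝ → ℝ} (h : IsGlobalMonotone d a f) {r : ℝ}
    (hr : 0 < r) : f r ≤ 1 := by
  have hflow := h.1.1.isRadialFlow
  rw [interval_top] at hflow
  refine le_one_of_isRadialFlow hr hflow h.2 fun s hs => mul_nonneg hs.le ?_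
  rw [← derivWithin_of_isOpen isOpen_Ioi (show s ∈ Ioi (0 : ℝ) from hs)]
  exact h.2.derivWithin_nonneg

lemma IsGlobalMonotone.eq_solution {d a : ℝ} (hd : 0 < d) (ha : 0 < a) {f : ℝ → ℝ}
    (h : IsGlobalMonotone d a f) {r : ℝ} (hr : 0 < r) : f r = solution d a r := by
  refine h.1.eq_solution hd ha.ne' (fun s hs => ?_) ?_
  · rw [interval_top] at hs
    exact abs_le.2 ⟨by linarith [h.pos ha hs], h.le_one hs⟩
  · rw [interval_top]; exact hr

lemma IsGlobalMonotone.stays {d a : ℝ} (hd : 0 < d) (ha : 0 < a) {f : ℝ → ℝ}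
    (h : IsGlobalMonotone d a f) : Stays d a := by
  intro r hr
  rw [← h.eq_solution hd ha hr]
  exact ⟨h.pos ha hr, h.le_one hr⟩

lemma Stays.isGlobalMonotone {d a : ℝ} (hd : 0 < d) (ha : 0 < a) (h : Stays d a) :
    IsGlobalMonotone d a (solution d a) := by
  refine ⟨isSolutionFromZero_solution hd ha.ne' EReal.zero_lt_top fun r hr => ?_,
    h.monotoneOn hd ha⟩
  rw [interval_top] at hr
  have := h r hr
  exact abs_le.2 ⟨by linarith [this.1], this.2⟩

theorem existsUnique_isGlobalMonotone {d : ℝ} (hd : 0 < d) :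
    ∃! A : ℝ, 0 < A ∧ ∃ f : ℝ → ℝ, IsGlobalMonotone d A f := by
  obtain ⟨A, hA, hs⟩ := exists_stays hd
  refine ⟨A, ⟨hA, _, hs.isGlobalMonotone hd hA⟩, ?_⟩
  rintro B ⟨hB, f, hf⟩
  exact (hf.stays hd hB).unique hd hB hA hs

/-! ### Asymptotic expansion at infinity -/

/-- Maximum principle with the barrier `C / r⁴`, which satisfies
`B'' + B'/r - B ≤ - B / 2` for `r ≥ 6`. -/
lemma le_div_pow_four {u U U' : ℝ → ℝ} {r₀ C K : ℝ} (hr₀ : 6 ≤ r₀)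
    (hu : ∀ r, r₀ ≤ r → HasDerivAt u (U r / r) r) (hU : ∀ r, r₀ ≤ r → HasDerivAt U (U' r) r)
    (hle : ∀ r, r₀ ≤ r → 0 < u r → r * (u r - K / r ^ 4) ≤ U' r) (hlim : Tendsto u atTop (𝓝 0))
    (hK : 0 ≤ K) (hC : 2 * K + 1 ≤ C) (h0 : u r₀ ≤ C / r₀ ^ 4) :
    ∀ r, r₀ ≤ r → u r ≤ C / r ^ 4 := by
  by_contra! hcon
  obtain ⟨r₁, hr₁, hlt⟩ := hcon
  have hpos : ∀ r, r₀ ≤ r → 0 < r := fun r hr => by linarith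
  have hC0 : 0 < C := by linarith
  let w : ℝ → ℝ := fun r => u r - C / r ^ 4
  let y : ℝ → ℝ := fun r => U r + 4 * C / r ^ 4
  have hpow : ∀ r, r₀ ≤ r → ∀ c, HasDerivAt (fun r : ℝ => c / r ^ 4) (-(4 * c / r ^ 5)) r := by
    intro r hr c
    have hr0 := (hpos r hr).ne'
    convert! (hasDerivAt_const r c).div (hasDerivAt_pow 4 r) (pow_ne_zero 4 hr0) using 1
    field_simp
    ring
  have hw : ∀ r, r₀ ≤ r → HasDerivAt w (y r / r) r := by
    intro r hr
    have hr0 := (hpos r hr).ne'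
    convert! (hu r hr).sub (hpow r hr C) using 1
    simp only [y]
    field_simp
    ring
  have hy : ∀ r, r₀ ≤ r → HasDerivAt y (U' r - 16 * C / r ^ 5) r := by
    intro r hr
    convert! (hU r hr).add (hpow r hr (4 * C)) using 1
    ring
  have hwle : ∀ᶠ r in atTop, w r < w r₁ := by
    have h1 : 0 < w r₁ := by simp only [w]; linarith
    filter_upwards [hlim.eventually (gt_mem_nhds h1), eventually_gt_atTop 0] with r hr hr0
    have : 0 ≤ C / r ^ 4 := by positivity
    simp only [w] at hr ⊢
    linarith
  obtain ⟨N, hN, hN₁⟩ := (hwle.and (eventually_gt_atTop r₁)).exists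
  obtain ⟨x, hx, hmax⟩ := isCompact_Icc.exists_isMaxOn (nonempty_Icc.2 (hr₁.trans hN₁.le))
    (fun r hr => (hw r hr.1).continuousAt.continuousWithinAt : ContinuousOn w (Icc r₀ N))
  have hxr₁ : w r₁ ≤ w x := hmax ⟨hr₁, hN₁.le⟩
  have hwr₁ : 0 < w r₁ := by simp only [w]; linarith
  have hx0 : r₀ < x := lt_of_le_of_ne hx.1 fun he => by
    have : w x ≤ 0 := by rw [← he]; simp only [w]; linarith
    linarith
  have hxN : x < N := lt_of_le_of_ne hx.2 fun he => by rw [he] at hxr₁; linarith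
  have hxp := hpos x hx.1
  refine not_isLocalMax_of_hasDerivAt (w := w) hxp ?_ (hy x hx.1) ?_
    (hmax.isLocalMax (Icc_mem_nhds hx0 hxN))
  · filter_upwards [lt_mem_nhds hx0] with r hr using hw r hr.le
  · have hux : C / x ^ 4 < u x := by
      have := hwr₁.trans_le hxr₁
      simp only [w] at this
      linarith
    have h1 := hle x hx.1 (lt_of_le_of_lt (by positivity) hux)
    have h2 : x * (C / x ^ 4 - K / x ^ 4) < x * (u x - K / x ^ 4) :=
      mul_lt_mul_of_pos_left (by linarith) hxp
    have h3 : 16 * C / x ^ 5 ≤ x * (C / x ^ 4 - K / x ^ 4) := by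
      have e : x * (C / x ^ 4 - K / x ^ 4) = (C - K) * x ^ 2 / x ^ 5 := by field_simp
      rw [e]
      refine div_le_div_of_nonneg_right ?_ (by positivity)
      have h36 : (36 : ℝ) ≤ x ^ 2 := by nlinarith
      nlinarith
    linarith

/-- The expansion at infinity. With `v = 1 - d²/(2r²)`, the difference `u = f - v` solves
`u'' + u'/r = c u + e` with `c → 2` and `0 ≤ e = O(r⁻⁴)`. -/
theorem Stays.isBigO_atTop {d a : ℝ} (hd : 0 < d) (ha : 0 < a) (h : Stays d a) :
    (fun r : ℝ => solution d a r - (1 - d ^ 2 / (2 * r ^ 2))) =O[atTop]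
      (fun r : ℝ => 1 / r ^ 4) := by
  set K := d ^ 4 / 4 + 2 * d ^ 2 with hK
  have hK0 : 0 ≤ K := by positivity
  let u : ℝ → ℝ := fun r => solution d a r - (1 - d ^ 2 / (2 * r ^ 2))
  let U : ℝ → ℝ := fun r => momentum d a r - d ^ 2 / r ^ 2
  let U' : ℝ → ℝ := fun r => d ^ 2 * solution d a r / r
    - r * (solution d a r * (1 - solution d a r ^ 2)) + 2 * d ^ 2 / r ^ 3
  have hu : ∀ r, 0 < r → HasDerivAt u (U r / r) r := by
    intro r hr
    have h1 : HasDerivAt (fun r : ℝ => 1 - d ^ 2 / (2 * r ^ 2)) (d ^ 2 / r ^ 3) r := by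
      convert! ((hasDerivAt_const r (d ^ 2)).div ((hasDerivAt_pow 2 r).const_mul 2)
        (by positivity)).const_sub 1 using 1
      field_simp
      ring
    convert! (hasDerivAt_solution hd a hr).sub h1 using 1
    simp only [U]
    field_simp
  have hU : ∀ r, 0 < r → HasDerivAt U (U' r) r := by
    intro r hr
    have h1 : HasDerivAt (fun r : ℝ => d ^ 2 / r ^ 2) (-(2 * d ^ 2 / r ^ 3)) r := by
      convert! (hasDerivAt_const r (d ^ 2)).div (hasDerivAt_pow 2 r) (by positivity) using 1
      field_simp
      ring
    have h2 := hasDerivAt_momentum hd a hr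
    rw [cutoff_of_le (h r hr).1.le (h r hr).2] at h2
    convert! h2.sub h1 using 1
    simp only [U']
    ring
  have hlim : Tendsto u atTop (𝓝 0) := by
    have h1 : Tendsto (fun r : ℝ => 1 - d ^ 2 / (2 * r ^ 2)) atTop (𝓝 (1 - 0)) := by
      refine tendsto_const_nhds.sub (tendsto_const_nhds.div_atTop ?_)
      exact (tendsto_pow_atTop two_ne_zero).const_mul_atTop two_pos
    simpa [u] using (h.tendsto hd ha).sub h1
  obtain ⟨R, hR⟩ := eventually_atTop.1
    ((h.tendsto hd ha).eventually (lt_mem_nhds (by norm_num : (9 / 10 : ℝ) < 1)))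
  set r₀ := max (max 6 (3 * d)) R with hr₀
  have h6 : 6 ≤ r₀ := (le_max_left _ _).trans (le_max_left _ _)
  -- the linearised equation for `u`
  have heq : ∀ r, r₀ ≤ r → ∃ c e : ℝ, 1 ≤ c ∧ 0 ≤ e ∧ e ≤ K / r ^ 4 ∧
      U' r = r * (c * u r + e) := by
    intro r hr
    have hr0 : 0 < r := by linarith
    have h3d : 3 * d ≤ r := (le_max_right _ _).trans ((le_max_left _ _).trans hr)
    have hF := hR r ((le_max_right _ _).trans hr)
    set F := solution d a r with hFdef
    set s := d ^ 2 / r ^ 2 with hs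
    have hs0 : 0 ≤ s := by positivity
    have hs1 : s ≤ 1 / 9 := by
      rw [hs, div_le_div_iff₀ (by positivity) (by norm_num)]
      nlinarith
    have hv : 9 / 10 ≤ 1 - s / 2 := by linarith
    have hsr : d ^ 2 / (2 * r ^ 2) = s / 2 := by rw [hs]; field_simp
    refine ⟨s - 1 + F ^ 2 + F * (1 - s / 2) + (1 - s / 2) ^ 2,
      (1 - s / 2) * (s ^ 2 / 4) + 2 * s / r ^ 2, by nlinarith, ?_, ?_, ?_⟩
    · have : 0 ≤ 1 - s / 2 := by linarith
      positivity
    · have e1 : K / r ^ 4 = s ^ 2 / 4 + 2 * s / r ^ 2 := by rw [hK, hs]; field_simp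
      rw [e1]
      have := mul_le_of_le_one_left (by positivity : 0 ≤ s ^ 2 / 4) (by linarith : 1 - s / 2 ≤ 1)
      linarith
    · have e2 : u r = F - (1 - s / 2) := by simp only [u]; rw [hsr]
      have e3 : U' r = r * (s * F - F * (1 - F ^ 2) + 2 * s / r ^ 2) := by
        simp only [U', hs]; rw [← hFdef]; field_simp
      rw [e2, e3]
      ring
  set C := max (2 * K + 1) (r₀ ^ 4 * |u r₀|) with hC
  have hr₀0 : 0 < r₀ := by linarith
  have hb : |u r₀| ≤ C / r₀ ^ 4 := by
    rw [le_div_iff₀ (by positivity), mul_comm]; exact le_max_right _ _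
  have hup := le_div_pow_four (u := u) (U := U) (U' := U') (K := K) (C := C) h6
    (fun r hr => hu r (hr₀0.trans_le hr)) (fun r hr => hU r (hr₀0.trans_le hr))
    (fun r hr hur => by
      obtain ⟨c, e, hc, he, heK, heq⟩ := heq r hr
      have hr0 := hr₀0.trans_le hr
      rw [heq]
      have : 0 ≤ K / r ^ 4 := by positivity
      exact mul_le_mul_of_nonneg_left (by nlinarith) hr0.le)
    hlim hK0 (le_max_left _ _) ((le_abs_self _).trans hb)
  have hlow := le_div_pow_four (u := fun r => -u r) (U := fun r => -U r) (U' := fun r => -U' r)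
    (K := K) (C := C) h6
    (fun r hr => by rw [neg_div]; exact (hu r (hr₀0.trans_le hr)).neg)
    (fun r hr => (hU r (hr₀0.trans_le hr)).neg)
    (fun r hr hur => by
      obtain ⟨c, e, hc, he, heK, heq⟩ := heq r hr
      have hr0 := hr₀0.trans_le hr
      rw [heq, ← mul_neg]
      exact mul_le_mul_of_nonneg_left (by nlinarith) hr0.le)
    (by simpa using hlim.neg) hK0 (le_max_left _ _) ((neg_le_abs _).trans hb)
  refine IsBigO.of_bound C ?_
  filter_upwards [eventually_ge_atTop r₀] with r hr
  have hr0 := hr₀0.trans_le hr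
  rw [Real.norm_eq_abs, Real.norm_eq_abs, abs_of_pos (by positivity : (0 : ℝ) < 1 / r ^ 4),
    mul_one_div]
  exact abs_le.2 ⟨by linarith [hlow r hr], hup r hr⟩

/-! ### Asymptotic expansion at zero -/

lemma potential_const {d : ℝ} (hd : 0 < d) (a : ℝ) {r : ℝ} (hr : 0 < r) :
    potential d (fun _ => a) r = a * r ^ 2 / (4 * (d + 1)) := by
  rw [potential_eq_moments hd continuous_const hr, lowMoment, highMoment,
    intervalIntegral.integral_mul_const, intervalIntegral.integral_mul_const, integral_id,
    integral_rpow (Or.inl (by linarith)), Real.zero_rpow (by linarith),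
    Real.rpow_add_one hr.ne', rpow_two_mul_add_one hr]
  have hXY := rpow_neg_mul_rpow hr d
  have h1 : 2 * d + 1 + 1 ≠ 0 := by linarith
  have h2 : d + 1 ≠ 0 := by linarith
  have e : r ^ (-d) * r ^ (-d) * ((r ^ d * r ^ d * r * r - 0) / (2 * d + 1 + 1) * a)
      = r ^ 2 / (2 * d + 1 + 1) * a := by
    field_simp
    linear_combination (r ^ 2 * a * (r ^ (-d) * r ^ d + 1)) * hXY
  rw [e]
  field_simp
  ring

/-- The expansion at `0` with remainder `O(r^{d+2+k})`: two steps of Picard iteration in the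
integral equation, whose source is `a + O(r²) + O(r^{2d})`. -/
theorem isBigO_solution_zero {d k : ℝ} (hd : 0 < d) (hk2 : k ≤ 2) (hkd : k ≤ 2 * d) (a : ℝ) :
    (fun r : ℝ => solution d a r - a * (r ^ d - 1 / (4 * (d + 1)) * r ^ (d + 2))) =O[𝓝[>] 0]
      (fun r : ℝ => r ^ (d + 2 + k)) := by
  have hg := continuous_profile hd a
  obtain ⟨M, hM⟩ := isCompact_Icc.exists_bound_of_continuousOn (s := Icc (0 : ℝ) 1)
    hg.continuousOn
  have hM0 : 0 ≤ M := (norm_nonneg _).trans (hM 0 ⟨le_rfl, zero_le_one⟩)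
  have hsrc : ∀ t ∈ Icc (0 : ℝ) 1, |source d (profile d a) t - a|
      ≤ M / (4 * d) * t ^ 2 + M ^ 3 * (t ^ d) ^ 2 := by
    intro t ht
    have h1 : |profile d a t - a| ≤ M / (4 * d) * t ^ 2 := by
      rw [profile_eq hd, sub_sub_cancel_left, abs_neg]
      refine (abs_potential_le_const hd ht.1 (M := M) fun s hs => (abs_source_le _ _ _).trans
        (hM s ⟨hs.1, hs.2.trans ht.2⟩)).trans_eq (by ring)
    have hgM : |profile d a t| ≤ M := hM t ht
    set z := t ^ d * profile d a t with hz
    have h2 : |1 - cutoff z| ≤ z ^ 2 := by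
      rw [abs_of_nonneg (by linarith [cutoff_le_one z])]
      linarith [le_max_right 0 (1 - z ^ 2), show cutoff z = max 0 (1 - z ^ 2) from rfl]
    have h3 : z ^ 2 ≤ (t ^ d) ^ 2 * M ^ 2 := by
      rw [hz, mul_pow]
      refine mul_le_mul_of_nonneg_left ?_ (sq_nonneg _)
      rw [← sq_abs (profile d a t)]
      exact pow_le_pow_left₀ (abs_nonneg _) hgM 2
    have e : source d (profile d a) t - a
        = (profile d a t - a) - profile d a t * (1 - cutoff z) := by simp only [source, hz]; ring
    rw [e]
    refine (abs_sub _ _).trans (add_le_add h1 ?_)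
    rw [abs_mul]
    calc |profile d a t| * |1 - cutoff z| ≤ M * ((t ^ d) ^ 2 * M ^ 2) :=
          mul_le_mul hgM (h2.trans h3) (abs_nonneg _) hM0
      _ = _ := by ring
  refine IsBigO.of_bound ((M / (4 * d) + M ^ 3) / (4 * d)) ?_
  filter_upwards [Ioo_mem_nhdsGT one_pos] with r hr
  have hr0 : 0 < r := hr.1
  have hrd : 0 < r ^ d := Real.rpow_pos_of_pos hr0 d
  have hrk : 0 < r ^ k := Real.rpow_pos_of_pos hr0 k
  have hkr2 : r ^ 2 ≤ r ^ k := by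
    rw [← Real.rpow_natCast r 2]
    exact Real.rpow_le_rpow_of_exponent_ge hr0 hr.2.le (by exact_mod_cast hk2)
  have hkrd : (r ^ d) ^ 2 ≤ r ^ k := by
    rw [← Real.rpow_natCast (r ^ d) 2, ← Real.rpow_mul hr0.le]
    exact Real.rpow_le_rpow_of_exponent_ge hr0 hr.2.le (by push_cast; linarith)
  have e : solution d a r - a * (r ^ d - 1 / (4 * (d + 1)) * r ^ (d + 2))
      = -(r ^ d * potential d (fun t => source d (profile d a) t - a) r) := by
    rw [← potential_sub hd (continuous_source_profile hd a) continuous_const,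
      potential_const hd a hr0, solution, profile_eq hd a r, Real.rpow_add hr0, Real.rpow_two]
    ring
  have hpot : |potential d (fun t => source d (profile d a) t - a) r|
      ≤ (M / (4 * d) + M ^ 3) * r ^ k * r ^ 2 / (4 * d) := by
    refine abs_potential_le_const hd hr0.le fun t ht => ?_
    refine (hsrc t ⟨ht.1, ht.2.trans hr.2.le⟩).trans ?_
    have h1 : t ^ 2 ≤ r ^ k := (pow_le_pow_left₀ ht.1 ht.2 2).trans hkr2
    have h2 : (t ^ d) ^ 2 ≤ r ^ k := (pow_le_pow_left₀ (Real.rpow_nonneg ht.1 d)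
      (Real.rpow_le_rpow ht.1 ht.2 hd.le) 2).trans hkrd
    rw [add_mul]
    exact add_le_add (mul_le_mul_of_nonneg_left h1 (by positivity))
      (mul_le_mul_of_nonneg_left h2 (by positivity))
  rw [e, norm_neg, norm_mul, Real.norm_eq_abs, Real.norm_eq_abs, Real.norm_eq_abs,
    abs_of_pos hrd, abs_of_pos (Real.rpow_pos_of_pos hr0 (d + 2 + k)), Real.rpow_add hr0,
    Real.rpow_add hr0, Real.rpow_two]
  refine (mul_le_mul_of_nonneg_left hpot hrd.le).trans_eq ?_
  ring

/-! ### Continuity in the parameter -/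

/-- Continuity of `d ↦ g^{(d)}` into `L^∞([0, α])`. -/
theorem exists_continuous_Lp {A : Ioi (0 : ℝ) → ℝ} (hA : Continuous A) (α : ℝ) :
    ∃ G : Ioi (0 : ℝ) → Lp ℝ ∞ (volume.restrict (Icc 0 α)), Continuous G ∧
      ∀ d : Ioi (0 : ℝ), G d =ᵐ[volume.restrict (Icc 0 α)] profile d (A d) := by
  have hmem : ∀ d : Ioi (0 : ℝ), MemLp (profile d (A d)) ∞ (volume.restrict (Icc 0 α)) := by
    intro d
    have hc := continuous_profile d.2 (A d)
    obtain ⟨C, hC⟩ := isCompact_Icc.exists_bound_of_continuousOn (s := Icc 0 α) hc.continuousOn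
    exact memLp_top_of_bound hc.aestronglyMeasurable C
      ((ae_restrict_iff' measurableSet_Icc).2 (Eventually.of_forall hC))
  refine ⟨fun d => (hmem d).toLp _, ?_, fun d => (hmem d).coeFn_toLp⟩
  rw [continuous_iff_continuousAt]
  intro d₀
  rw [ContinuousAt, Metric.tendsto_nhds]
  intro e he
  have hc : Tendsto (fun d => (d, A d)) (𝓝 d₀) (𝓝 (d₀, A d₀)) :=
    (continuous_id.prodMk hA).tendsto d₀
  filter_upwards [hc.eventually (eventually_profile_near d₀ (A d₀) α (half_pos he))] with d hd
  rw [dist_eq_norm]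
  refine lt_of_le_of_lt (Lp.norm_le_of_ae_bound (C := e / 2) (by positivity) ?_) ?_
  · filter_upwards [Lp.coeFn_sub ((hmem d).toLp _) ((hmem d₀).toLp _), (hmem d).coeFn_toLp,
      (hmem d₀).coeFn_toLp, ae_restrict_mem measurableSet_Icc] with r h1 h2 h3 h4
    rw [h1, Pi.sub_apply, h2, h3]
    exact hd r h4
  · simp only [ENNReal.toReal_top, inv_zero, Real.rpow_zero]
    norm_num
    linarith

end GinzburgLandau

theorem mainTheorem12 :
    -- for each `a > 0`, existence and uniqueness of the solution with `f ~ a r^d` at `0`: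
    -- there is one on a largest interval, and every other one is a restriction of it
    (∀ d : ℝ, 0 < d → ∀ a : ℝ, 0 < a →
      ∃ (R : EReal) (f : ℝ → ℝ), GinzburgLandau.IsSolutionFromZero d a R f ∧
        ∀ (R' : EReal) (h : ℝ → ℝ), GinzburgLandau.IsSolutionFromZero d a R' h →
          R' ≤ R ∧ EqOn h f (GinzburgLandau.interval R')) ∧
    -- existence and uniqueness of `A_d`
    (∀ d : ℝ, 0 < d →
      ∃! A : ℝ, 0 < A ∧ ∃ f : ℝ → ℝ, GinzburgLandau.IsGlobalMonotone d A f) ∧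
    -- the properties of `A_d` and `f_d`
    (∀ (A : ℝ → ℝ) (f : ℝ → ℝ → ℝ),
      (∀ d : ℝ, 0 < d → 0 < A d ∧ GinzburgLandau.IsGlobalMonotone d (A d) (f d)) →
        (∀ d : ℝ, 0 < d →
          (fun r : ℝ => f d r - (1 - d ^ 2 / (2 * r ^ 2))) =O[atTop]
            (fun r : ℝ => 1 / r ^ 4)) ∧
        (∀ d : ℝ, 1 ≤ d →
          (fun r : ℝ => f d r - A d * (r ^ d - 1 / (4 * (d + 1)) * r ^ (d + 2))) =O[𝓝[>] 0]
            (fun r : ℝ => r ^ (d + 4))) ∧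
        (∀ d : ℝ, 0 < d → d < 1 →
          (fun r : ℝ => f d r - A d * (r ^ d - 1 / (4 * (d + 1)) * r ^ (d + 2))) =O[𝓝[>] 0]
            (fun r : ℝ => r ^ (3 * d + 2))) ∧
        (∀ α : ℝ, 0 < α →
          ∃ G : Ioi (0 : ℝ) → Lp ℝ ∞ (volume.restrict (Icc 0 α)),
            Continuous G ∧
              ∀ d : Ioi (0 : ℝ),
                G d =ᵐ[volume.restrict (Icc 0 α)]
                  fun r : ℝ => r ^ (-(d : ℝ)) * f (d : ℝ) r)) := by
  refine ⟨fun d hd a ha => GinzburgLandau.exists_maximal_solution hd ha,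
    fun d hd => GinzburgLandau.existsUnique_isGlobalMonotone hd, fun A f hAf => ?_⟩
  have hsol : ∀ d, 0 < d → ∀ r, 0 < r → f d r = GinzburgLandau.solution d (A d) r :=
    fun d hd r hr => (hAf d hd).2.eq_solution hd (hAf d hd).1 hr
  have hstays : ∀ d, 0 < d → GinzburgLandau.Stays d (A d) := fun d hd =>
    (hAf d hd).2.stays hd (hAf d hd).1
  have hzero : ∀ d k, 0 < d → k ≤ 2 → k ≤ 2 * d →
      (fun r : ℝ => f d r - A d * (r ^ d - 1 / (4 * (d + 1)) * r ^ (d + 2))) =O[𝓝[>] 0]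
        (fun r : ℝ => r ^ (d + 2 + k)) := by
    intro d k hd hk2 hkd
    refine (GinzburgLandau.isBigO_solution_zero hd hk2 hkd (A d)).congr' ?_ EventuallyEq.rfl
    filter_upwards [self_mem_nhdsWithin] with r hr
    rw [hsol d hd r hr]
  refine ⟨fun d hd => ?_, fun d hd => ?_, fun d hd hd1 => ?_, fun α _ => ?_⟩
  · refine ((hstays d hd).isBigO_atTop hd (hAf d hd).1).congr' ?_ EventuallyEq.rfl
    filter_upwards [eventually_gt_atTop 0] with r hr
    rw [hsol d hd r hr]
  · convert hzero d 2 (by linarith) le_rfl (by linarith) using 3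
    ring
  · convert hzero d (2 * d) hd (by linarith) le_rfl using 3
    ring
  · have hA : Continuous fun d : Ioi (0 : ℝ) => A d :=
      GinzburgLandau.continuous_of_stays (fun d => (hAf d d.2).1) fun d => hstays d d.2
    obtain ⟨G, hG, hGe⟩ := GinzburgLandau.exists_continuous_Lp hA α
    refine ⟨G, hG, fun d => (hGe d).trans ?_⟩
    -- the two sides may differ at the null point `r = 0`
    filter_upwards [ae_restrict_mem measurableSet_Icc,
      ae_restrict_of_ae (Measure.ae_ne volume (0 : ℝ))] with r hr hr0
    have hr' : 0 < r := lt_of_le_of_ne hr.1 (Ne.symm hr0)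
    rw [hsol d d.2 r hr', GinzburgLandau.profile_eq_rpow_neg_mul _ _ hr']
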